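/- Let $p$ be a prime and let $v_p$ denote the $p$-adic valuation on $\mathbb{Z}$, with $v_p(0)=\infty$. For a non-negative integer $\omega$, a real resolution of $\omega$ is a sequence $(\gamma_i)_{i\ge 0}$ with terms in $\{0\}\cup[1,\infty)$ such that $\gamma_i\ge p\,\gamma_{i+1}$ for all $i\ge 0$ and $\sum_{i=0}^\infty\gamma_i=\omega$; an integral resolution of $\omega$ is such a sequence all of whose terms are non-negative integers. For every $\omega$ there is a lexicographically least real resolution $(\widetilde\gamma_i(\omega))_{i\ge0}$ of $\omega$ and a lexicographically least integral resolution $(\widehat\gamma_i(\omega))_{i\ge0}$ of $\omega$, called the real and the integral minimal resolution of $\omega$; each has only finitely many non-zero terms. Theorem. Let $f,g\in\mathbb{Z}[x]$ be monic polynomials with resultant $r$, and let $s_1,s_2$ be non-negative integers such that $v_p(f(n))\ge s_1$ and $v_p(g(n))\ge s_2$ for every integer $n$. Assume that the maximum $$S=\max_{n\in\mathbb{Z}}\min\{v_p(f(n)),v_p(g(n))\}$$ exists and is finite. Then, for $\gamma=\widetilde\gamma$ as well as for $\gamma=\widehat\gamma$, $$v_p(r)\ \ge\ S-\max\{s_1,s_2\}+p\sum_{i=0}^{\infty}p^i\,\gamma_i(s_1)\,\gamma_i(s_2).$$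 (If $r=0$, the left-hand side is $\infty$ and the inequality holds trivially.) -/

import Mathlib

/-- The allowed terms of a real resolution: `0` and the real numbers that are at least `1`. -/
def realTerms : Set ℝ := {x | x = 0 ∨ 1 ≤ x}

/-- The allowed terms of an integral resolution: the non-negative integers. -/
def integralTerms : Set ℝ := Set.range (fun n : ℕ => (n : ℝ))

/-- `γ` is a resolution of `ω` (for the base `p`) with terms in `A`: each term is at least `p` times
the next one, and the terms sum up to `ω`. -/
def IsResolution (A : Set ℝ) (p : ℕ) (ω : ℝ) (γ : ℕ → ℝ) : Prop :=
  (∀ i, γ i ∈ A) ∧ (∀ i, (p : ℝ) * γ (i + 1) ≤ γ i) ∧ HasSum γ ω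

/-- `γ` is the lexicographically least resolution of `ω` with terms in `A`. -/
def IsMinimalResolution (A : Set ℝ) (p : ℕ) (ω : ℝ) (γ : ℕ → ℝ) : Prop :=
  IsLeast {x : Lex (ℕ → ℝ) | IsResolution A p ω (ofLex x)} (toLex γ)

theorem integralTerms_subset : integralTerms ⊆ realTerms := by
  rintro _ ⟨n, rfl⟩
  rcases Nat.eq_zero_or_pos n with h | h
  · left; simp [h]
  · right; exact Nat.one_le_cast.mpr h

theorem IsResolution.mono {A B : Set ℝ} (hAB : A ⊆ B) {p : ℕ} {ω : ℝ} {γ : ℕ → ℝ}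
    (h : IsResolution A p ω γ) : IsResolution B p ω γ :=
  ⟨fun i => hAB (h.1 i), h.2⟩

theorem IsResolution.nonneg {p : ℕ} {ω : ℝ} {γ : ℕ → ℝ}
    (h : IsResolution realTerms p ω γ) (i : ℕ) : 0 ≤ γ i := by
  rcases h.1 i with h | h <;> linarith

theorem IsResolution.pow_mul_le {A : Set ℝ} {p : ℕ} {ω : ℝ} {γ : ℕ → ℝ}
    (h : IsResolution A p ω γ) (i k : ℕ) : (p : ℝ) ^ k * γ (i + k) ≤ γ i := by
  induction k with
  | zero => simp
  | succ k ih =>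
    calc (p : ℝ) ^ (k + 1) * γ (i + (k + 1)) = (p : ℝ) ^ k * (p * γ (i + k + 1)) := by
          rw [pow_succ, mul_assoc, add_assoc]
      _ ≤ (p : ℝ) ^ k * γ (i + k) := by gcongr; exact h.2.1 _
      _ ≤ γ i := ih

theorem IsResolution.geom_le {p : ℕ} {ω : ℝ} {γ : ℕ → ℝ}
    (h : IsResolution realTerms p ω γ) {n : ℕ} (hn : γ n ≠ 0) :
    ∑ j ∈ Finset.range (n + 1), (p : ℝ) ^ j ≤ ω := by
  have h1 : 1 ≤ γ n := (h.1 n).resolve_left hn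
  calc ∑ j ∈ Finset.range (n + 1), (p : ℝ) ^ j
      = ∑ j ∈ Finset.range (n + 1), (p : ℝ) ^ (n - j) := by
        rw [← Finset.sum_range_reflect]
        refine Finset.sum_congr rfl fun j _ => ?_
        congr 1
    _ ≤ ∑ j ∈ Finset.range (n + 1), γ j := by
        refine Finset.sum_le_sum fun j hj => ?_
        have hj' : j ≤ n := by simpa [Nat.lt_succ_iff] using hj
        have := h.pow_mul_le j (n - j)
        rw [Nat.add_sub_cancel' hj'] at this
        have h0 : (0 : ℝ) ≤ (p : ℝ) ^ (n - j) := by positivity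
        nlinarith
    _ ≤ ω := sum_le_hasSum _ (fun i _ => h.nonneg i) h.2.2

theorem le_sum_range_pow {p : ℕ} (hp : 1 ≤ p) (n : ℕ) : n ≤ ∑ j ∈ Finset.range n, p ^ j := by
  calc n = ∑ j ∈ Finset.range n, 1 := by simp
    _ ≤ _ := Finset.sum_le_sum fun j _ => Nat.one_le_pow _ _ hp

theorem exists_isMinimalResolution_integral (p : ℕ) [hp : Fact p.Prime] (s : ℕ) :
    ∃ γ, IsMinimalResolution integralTerms p s γ := by
  set R : Set (Lex (ℕ → ℝ)) := {x | IsResolution integralTerms p s (ofLex x)} with hR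
  have hfin : R.Finite := by
    let F : (Fin s → Fin (s + 1)) → Lex (ℕ → ℝ) := fun c =>
      toLex fun i => if h : i < s then ((c ⟨i, h⟩ : ℕ) : ℝ) else 0
    refine (Set.finite_range F).subset fun x hx => ?_
    have hx' : IsResolution integralTerms p s (ofLex x) := hx
    have hxr := hx'.mono integralTerms_subset
    choose c hc using hx'.1
    have hle : ∀ i, c i ≤ s := fun i => by
      have : ofLex x i ≤ s := le_hasSum hx'.2.2 i (fun j _ => hxr.nonneg j)
      rw [← hc i] at this
      change ((c i : ℕ) : ℝ) ≤ s at this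
      exact_mod_cast this
    refine ⟨fun i => ⟨c i, Nat.lt_succ_of_le (hle i)⟩, ?_⟩
    apply ofLex.injective
    funext i
    by_cases hi : i < s
    · simpa [F, hi] using hc i
    · have : ofLex x i = 0 := by
        by_contra hne
        have h1 := hxr.geom_le hne
        have h2 := le_sum_range_pow hp.out.one_le (i + 1)
        have h3 : ∑ j ∈ Finset.range (i + 1), p ^ j ≤ s := by exact_mod_cast h1
        omega
      simp [F, hi, this]
  have hne : R.Nonempty := by
    refine ⟨toLex fun i => if i = 0 then (s : ℝ) else 0, fun i => ?_, fun i => ?_, ?_⟩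
    · by_cases hi : i = 0
      · exact ⟨s, by simp [hi]⟩
      · exact ⟨0, by simp [hi]⟩
    · by_cases hi : i = 0 <;> simp [hi]
    · exact hasSum_ite_eq 0 (s : ℝ)
  obtain ⟨x, hx, hmin⟩ := Set.exists_min_image R id hfin hne
  exact ⟨ofLex x, hx, fun y hy => hmin y hy⟩

theorem exists_isMinimalResolution_real (p : ℕ) [hp : Fact p.Prime] (s : ℕ) :
    ∃ γ, IsMinimalResolution realTerms p s γ := by
  have hp0 : (0 : ℝ) < p := by exact_mod_cast hp.out.pos
  set N := Nat.findGreatest (fun n => ∑ j ∈ Finset.range n, p ^ j ≤ s) s with hN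
  have hN1 : ∑ j ∈ Finset.range N, p ^ j ≤ s :=
    Nat.findGreatest_spec (P := fun n => ∑ j ∈ Finset.range n, p ^ j ≤ s) (Nat.zero_le s) (by simp)
  have hN2 : ∀ n, ∑ j ∈ Finset.range n, p ^ j ≤ s → n ≤ N := fun n hn =>
    Nat.le_findGreatest ((le_sum_range_pow hp.out.one_le n).trans hn) hn
  set D : ℝ := ∑ j ∈ Finset.range N, ((p : ℝ) ^ j)⁻¹ with hD
  have hD0 : 0 ≤ D := Finset.sum_nonneg fun j _ => by positivity
  have hDs : D = 0 → s = 0 := fun h => by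
    by_contra hs
    have h1 : 1 ≤ N := hN2 1 (by simp; omega)
    have : (0 : ℝ) < D := Finset.sum_pos (fun j _ => by positivity) ⟨0, by simp; omega⟩
    linarith
  set x : ℝ := s / D with hx
  have hx0 : 0 ≤ x := by positivity
  have hxD : x * D = s := by
    by_cases h : D = 0
    · simp [h, hDs h]
    · rw [hx]; field_simp
  set γ : ℕ → ℝ := fun i => if i < N then x * ((p : ℝ) ^ i)⁻¹ else 0 with hγ
  have hsum : HasSum γ s := by
    have : ∑ i ∈ Finset.range N, γ i = s := by
      rw [← hxD, hD, Finset.mul_sum]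
      exact Finset.sum_congr rfl fun i hi => by simp [hγ, Finset.mem_range.mp hi]
    rw [← this]
    exact hasSum_sum_of_ne_finset_zero fun i hi => by simp at hi; simp [hγ, hi]
  refine ⟨γ, ⟨fun i => ?_, fun i => ?_, hsum⟩, fun y hy => ?_⟩
  · change γ i = 0 ∨ 1 ≤ γ i
    by_cases hi : i < N
    · right
      have hDpos : 0 < D := Finset.sum_pos (fun j _ => by positivity) ⟨i, by simpa using hi⟩
      have hgeom : (p : ℝ) ^ (N - 1) * D ≤ s := by
        calc (p : ℝ) ^ (N - 1) * D = ∑ j ∈ Finset.range N, (p : ℝ) ^ (N - 1 - j) := by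
              rw [hD, Finset.mul_sum]
              refine Finset.sum_congr rfl fun j hj => ?_
              have : j < N := by simpa using hj
              rw [pow_sub₀ _ hp0.ne' (show j ≤ N - 1 by omega)]
          _ = ∑ j ∈ Finset.range N, (p : ℝ) ^ j := Finset.sum_range_reflect (fun j => (p : ℝ) ^ j) N
          _ ≤ s := by exact_mod_cast hN1
      have hxp : (p : ℝ) ^ i ≤ x := by
        refine le_trans ?_ ((le_div_iff₀ hDpos).2 hgeom)
        exact pow_le_pow_right₀ (by exact_mod_cast hp.out.one_le) (by omega)
      simp only [hγ, hi, if_true]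
      rw [← div_eq_mul_inv, le_div_iff₀ (by positivity)]
      simpa using hxp
    · left; simp [hγ, hi]
  · change (p : ℝ) * γ (i + 1) ≤ γ i
    by_cases hi : i + 1 < N
    · have hi' : i < N := by omega
      simp only [hγ, hi, hi', if_true]
      rw [pow_succ]
      apply le_of_eq
      field_simp
    · have h0 : γ (i + 1) = 0 := by simp [hγ, hi]
      rw [h0, mul_zero]
      simp only [hγ]
      split_ifs <;> positivity
  · have hy' : IsResolution realTerms p s (ofLex y) := hy
    by_contra hlt
    obtain ⟨i, hi, hlt⟩ : ∃ i, (∀ j < i, ofLex y j = γ j) ∧ ofLex y i < γ i := not_le.mp hlt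
    have hiN : i < N := by
      by_contra h
      have : γ i = 0 := by simp [hγ, h]
      linarith [hy'.nonneg i]
    have hle : ∀ j, ofLex y j ≤ γ j := fun j => by
      rcases lt_or_ge j i with hj | hj
      · exact (hi j hj).le
      · by_cases hjN : j < N
        · have h1 := hy'.pow_mul_le i (j - i)
          rw [Nat.add_sub_cancel' hj] at h1
          have h2 : γ i = (p : ℝ) ^ (j - i) * γ j := by
            simp only [hγ, hiN, hjN, if_true]
            rw [pow_sub₀ _ hp0.ne' hj]
            field_simp
          have h3 : (0 : ℝ) < (p : ℝ) ^ (j - i) := by positivity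
          refine le_of_mul_le_mul_left ?_ h3
          linarith
        · have h0 : ofLex y j = 0 := by
            by_contra hne
            have h1 := hy'.geom_le hne
            have := hN2 (j + 1) (by exact_mod_cast h1)
            omega
          simp [hγ, hjN, h0]
    exact absurd (hasSum_lt hle hlt hy'.2.2 hsum) (lt_irrefl _)

/-- The minimal (real) resolution of the natural number `s` for the prime `p`. -/
noncomputable def realMinimalResolution (p : ℕ) [Fact p.Prime] (s : ℕ) : ℕ → ℝ :=
  Classical.choose (exists_isMinimalResolution_real p s)

/-- The minimal integral resolution of the natural number `s` for the prime `p`. -/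
noncomputable def integralMinimalResolution (p : ℕ) [Fact p.Prime] (s : ℕ) : ℕ → ℝ :=
  Classical.choose (exists_isMinimalResolution_integral p s)

theorem realMinimalResolution_spec (p : ℕ) [Fact p.Prime] (s : ℕ) :
    IsMinimalResolution realTerms p s (realMinimalResolution p s) :=
  Classical.choose_spec (exists_isMinimalResolution_real p s)

theorem integralMinimalResolution_spec (p : ℕ) [Fact p.Prime] (s : ℕ) :
    IsMinimalResolution integralTerms p s (integralMinimalResolution p s) :=
  Classical.choose_spec (exists_isMinimalResolution_integral p s)

/-- The `p`-adic valuation of an integer, with the value `∞` at `0`. -/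
noncomputable def vp (p : ℕ) (n : ℤ) : ℕ∞ := emultiplicity (p : ℤ) n

/-!
Let `v` be the valuation of an algebraic closure of `ℚ_[p]`, normalised by `v p = 1`. The valuation
of a non-zero resultant is the sum of `v (α - β)` over the roots `α` of `f` and `β` of `g`. Cut each
valuation into slices: `sliceVal p k x` is the part of `v x` between `k` and `k + 1`, a number in
`[0, 1]`. For an integer `c`, let `A k c` be the sum of the slices of `c - α` over all `α`, and
define `B k c` by the roots of `g` in the same way. At each level `k` at most one residue class `c`
modulo `p ^ (k + 1)` has a non-zero slice at `α`, so the ultrametric inequality gives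
`v r ≥ ∑ k, ∑ c, A k c * B k c` (`sum_increment_mul_increment_le`).

The numbers `A k c` live on the tree of residue classes. They are natural numbers, since
`∑ i < k, A i c` is the valuation attached to the Gauss norm of `f (c + x)` with radius `p ^ (-k)`;
each `A k c` is at least the sum of the values at the `p` subclasses of `c`; and along the path of
each integer `n` they add up to at least `v (f n)`, truncated at the level considered.

The rest is combinatorics on this tree. Choosing repeatedly a subclass with at most a `p`-th of the
current value shows that `A k c` is at least the first term `minHead p s` of the minimal integral
resolution of any lower bound `s` for the growth along the paths through `c`. The minimal integral
resolution is greedy: after its first term, the minimal resolution of the remainder follows.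
By induction on the depth of the tree, each residue class modulo `p` contributes at least
`∑ p ^ i * γ i (s₁) * γ i (s₂)`, because a value of `A k c` or `B k c` larger than necessary costs
more than it saves further down (`greedyPairing_succ_le_of_le`). The class containing the integer
at which `S` is attained contributes in addition `S - max s₁ s₂`, if that is positive
(`IsValuationTree.greedyPairing_add_min_le_pairing`).

This proves the bound for integral minimal resolutions. The real minimal resolution of `t` has first
term at most `t / ∑ i < N, p ^ (-i)`, where `N` is the largest possible number of non-zero terms, so
by Chebyshev's sum inequality, applied to the integral resolutions, the real resolutions yield at
most the sum that the integral ones do (`sum_realMinimalResolution_le`).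
-/

/-! ### The greedy description of minimal integral resolutions -/

/-- `a + ⌊a / p⌋ + ⌊a / p ^ 2⌋ + ⋯`, the largest sum of an integral resolution with first
term `a` (for `p ≥ 2`; the value for `p ≤ 1` is irrelevant). -/
def maxResolved (p a : ℕ) : ℕ :=
  if _h : a = 0 ∨ p ≤ 1 then a else a + maxResolved p (a / p)
termination_by a
decreasing_by exact Nat.div_lt_self (by omega) (by omega)

theorem maxResolved_zero (p : ℕ) : maxResolved p 0 = 0 := by
  rw [maxResolved]; simp

theorem maxResolved_eq {p : ℕ} (hp : 2 ≤ p) (a : ℕ) :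
    maxResolved p a = a + maxResolved p (a / p) := by
  rcases Nat.eq_zero_or_pos a with rfl | ha
  · simp [maxResolved_zero]
  · rw [maxResolved, dif_neg (by omega)]

theorem le_maxResolved {p : ℕ} (hp : 2 ≤ p) (a : ℕ) : a ≤ maxResolved p a := by
  rw [maxResolved_eq hp]; omega

theorem maxResolved_mono {p : ℕ} (hp : 2 ≤ p) : Monotone (maxResolved p) := by
  intro a b hab
  induction b using Nat.strong_induction_on generalizing a with
  | _ b ih =>
    rcases Nat.eq_zero_or_pos b with rfl | hb
    · rw [Nat.le_zero.mp hab]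
    · rw [maxResolved_eq hp a, maxResolved_eq hp b]
      exact Nat.add_le_add hab (ih _ (Nat.div_lt_self hb hp) (Nat.div_le_div_right hab))

/-- The least `a` that is the first term of an integral resolution of `s`, found as the least `a`
for which `maxResolved p a` reaches `s`. -/
noncomputable def minHead (p s : ℕ) : ℕ := sInf {a | s ≤ maxResolved p a}

theorem le_maxResolved_minHead {p : ℕ} (hp : 2 ≤ p) (s : ℕ) :
    s ≤ maxResolved p (minHead p s) :=
  Nat.sInf_mem (s := {a | s ≤ maxResolved p a}) ⟨s, le_maxResolved hp s⟩

theorem minHead_le_of_le {p s a : ℕ} (h : s ≤ maxResolved p a) : minHead p s ≤ a :=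
  Nat.sInf_le h

theorem minHead_le {p : ℕ} (hp : 2 ≤ p) (s : ℕ) : minHead p s ≤ s :=
  minHead_le_of_le (le_maxResolved hp s)

theorem minHead_mono {p : ℕ} (hp : 2 ≤ p) : Monotone (minHead p) := fun _ t hst =>
  minHead_le_of_le (hst.trans (le_maxResolved_minHead hp t))

theorem minHead_succ_le {p : ℕ} (hp : 2 ≤ p) (s : ℕ) : minHead p (s + 1) ≤ minHead p s + 1 := by
  refine minHead_le_of_le ?_
  have h1 := le_maxResolved_minHead hp s
  have h2 : minHead p s / p ≤ (minHead p s + 1) / p := Nat.div_le_div_right (Nat.le_succ _)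
  have h3 := maxResolved_mono hp h2
  rw [maxResolved_eq hp] at h1 ⊢
  omega

/-- Any `a` that is at least the least first term of a resolution of `s` can be followed by the
minimal resolution of `s - a`. -/
theorem mul_minHead_sub_le {p : ℕ} (hp : 2 ≤ p) {s a : ℕ} (h : minHead p s ≤ a) :
    p * minHead p (s - a) ≤ a := by
  have h1 := (le_maxResolved_minHead hp s).trans (maxResolved_mono hp h)
  rw [maxResolved_eq hp] at h1
  have h2 : minHead p (s - a) ≤ a / p := minHead_le_of_le (by omega)
  calc p * minHead p (s - a) ≤ p * (a / p) := Nat.mul_le_mul_left _ h2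
    _ ≤ a := Nat.mul_div_le a p

theorem minHead_zero {p : ℕ} (hp : 2 ≤ p) : minHead p 0 = 0 := Nat.le_zero.mp (minHead_le hp 0)

theorem minHead_pos {p : ℕ} (hp : 2 ≤ p) {s : ℕ} (hs : 0 < s) : 0 < minHead p s := by
  by_contra h
  have := le_maxResolved_minHead hp s
  rw [Nat.eq_zero_of_not_pos h, maxResolved_zero] at this
  omega

/-- The resolution of `s` obtained by taking the least possible term at each step. -/
noncomputable def greedy (p : ℕ) : ℕ → ℕ → ℕ
  | s, 0 => minHead p s
  | s, i + 1 => greedy p (s - minHead p s) i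

/-- The first `n` terms of the pairing `∑ p ^ i * γ i (s) * γ i (t)` of greedy resolutions. -/
noncomputable def greedyPairing (p : ℕ) : ℕ → ℕ → ℕ → ℕ
  | 0, _, _ => 0
  | n + 1, s, t =>
    minHead p s * minHead p t + p * greedyPairing p n (s - minHead p s) (t - minHead p t)

theorem greedyPairing_eq_sum (p n s t : ℕ) :
    greedyPairing p n s t = ∑ i ∈ Finset.range n, p ^ i * greedy p s i * greedy p t i := by
  induction n generalizing s t with
  | zero => simp [greedyPairing]
  | succ n ih =>
    rw [greedyPairing, ih, Finset.sum_range_succ', Finset.mul_sum, add_comm]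
    congr 1
    · refine Finset.sum_congr rfl fun i _ => ?_
      simp only [greedy]; ring
    · simp [greedy]

theorem greedyPairing_comm (p n s t : ℕ) : greedyPairing p n s t = greedyPairing p n t s := by
  simp only [greedyPairing_eq_sum, mul_right_comm]

theorem greedyPairing_zero_left {p : ℕ} (hp : 2 ≤ p) (n t : ℕ) : greedyPairing p n 0 t = 0 := by
  induction n generalizing t with
  | zero => rfl
  | succ n ih => simp [greedyPairing, minHead_zero hp, ih]

/-- Raising `s` by one raises exactly one term of its greedy resolution, by one; the weight of that
term in the pairing is at most the first term of the other resolution. -/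
theorem greedyPairing_succ_le {p : ℕ} (hp : 2 ≤ p) (n s t : ℕ) :
    greedyPairing p n (s + 1) t ≤ greedyPairing p n s t + minHead p t := by
  induction n generalizing s t with
  | zero => simp [greedyPairing]
  | succ n ih =>
    have h0 := minHead_le hp s
    have h1 := minHead_succ_le hp s
    have h2 := minHead_mono hp (Nat.le_succ s)
    simp only [greedyPairing]
    rcases (show minHead p (s + 1) = minHead p s ∨ minHead p (s + 1) = minHead p s + 1 by
      simp only [Nat.succ_eq_add_one] at h2; omega) with h | h
    · rw [h, show s + 1 - minHead p s = s - minHead p s + 1 by omega]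
      have h3 := Nat.mul_le_mul_left p (ih (s - minHead p s) (t - minHead p t))
      have h4 := mul_minHead_sub_le hp (le_refl (minHead p t))
      rw [Nat.mul_add] at h3
      omega
    · rw [h, show s + 1 - (minHead p s + 1) = s - minHead p s by omega, Nat.add_mul]
      omega

theorem greedyPairing_add_le {p : ℕ} (hp : 2 ≤ p) (n s t d : ℕ) :
    greedyPairing p n (s + d) t ≤ greedyPairing p n s t + d * minHead p t := by
  induction d with
  | zero => simp
  | succ d ih =>
    have := greedyPairing_succ_le hp n (s + d) t
    rw [← Nat.add_assoc, Nat.succ_mul]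
    omega

/-- Among the pairs `(a, b)` of possible first terms, the least one minimises
`a * b + p * greedyPairing p n (s - a) (t - b)`. -/
theorem greedyPairing_succ_le_of_le {p : ℕ} (hp : 2 ≤ p) (n : ℕ) {s t a b : ℕ}
    (ha : minHead p s ≤ a) (has : a ≤ s) (hb : minHead p t ≤ b) (hbt : b ≤ t) :
    greedyPairing p (n + 1) s t ≤ a * b + p * greedyPairing p n (s - a) (t - b) := by
  obtain ⟨d, rfl⟩ := Nat.exists_eq_add_of_le ha
  obtain ⟨e, rfl⟩ := Nat.exists_eq_add_of_le hb
  set m := minHead p s with hm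
  set l := minHead p t with hl
  have h1 := greedyPairing_add_le hp n (s - (m + d)) (t - l) d
  rw [show s - (m + d) + d = s - m by omega] at h1
  have h2 := greedyPairing_add_le hp n (t - (l + e)) (s - (m + d)) e
  rw [show t - (l + e) + e = t - l by omega, greedyPairing_comm p n (t - l),
    greedyPairing_comm p n (t - (l + e))] at h2
  have h3 : p * minHead p (t - l) ≤ l := mul_minHead_sub_le hp hl.symm.le
  have h4 : p * minHead p (s - (m + d)) ≤ m + d := mul_minHead_sub_le hp (by omega)
  simp only [greedyPairing, ← hm, ← hl]
  -- Lower first `a` to `m` and then `b` to `l`, at the costs `h1` and `h2`.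
  have h5 := Nat.mul_le_mul_left p h1
  have h6 := Nat.mul_le_mul_left p h2
  have h7 := Nat.mul_le_mul_left d h3
  have h8 := Nat.mul_le_mul_left e h4
  nlinarith

/-- The version of `greedyPairing_succ_le_of_le` for first terms that may overshoot `s` and `t`:
the product then makes up for the overshoot as well. -/
theorem greedyPairing_succ_add_max_le {p : ℕ} (hp : 2 ≤ p) (n : ℕ) {s t a b : ℕ}
    (ha : minHead p s ≤ a) (hb : minHead p t ≤ b) (ha0 : 0 < a) (hb0 : 0 < b) :
    greedyPairing p (n + 1) s t + max (a - s) (b - t) ≤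
      a * b + p * greedyPairing p n (s - a) (t - b) := by
  have h := greedyPairing_succ_le_of_le hp n (s := s) (t := t) (a := min a s) (b := min b t)
    (le_min ha (minHead_le hp s)) (min_le_right _ _) (le_min hb (minHead_le hp t))
    (min_le_right _ _)
  rw [show s - min a s = s - a by omega, show t - min b t = t - b by omega] at h
  have h1 : min a s * min b t + (a - s) * b ≤ a * b := by
    calc _ ≤ min a s * b + (a - s) * b := by gcongr; exact min_le_left _ _
      _ = a * b := by rw [← Nat.add_mul]; congr 1; omega
  have h2 : min a s * min b t + a * (b - t) ≤ a * b := by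
    calc _ ≤ a * min b t + a * (b - t) := by gcongr; exact min_le_left _ _
      _ = a * b := by rw [← Nat.mul_add]; congr 1; omega
  have h3 : a - s ≤ (a - s) * b := Nat.le_mul_of_pos_right _ hb0
  have h4 : b - t ≤ a * (b - t) := Nat.le_mul_of_pos_left _ ha0
  omega

/-! ### Families of valuations on the tree of residue classes -/

/-- The difference of `W` between the residue class of `c` modulo `p ^ k` and the one modulo
`p ^ (k + 1)`; it belongs to the latter. -/
def increment (W : ℕ → ℤ → ℕ) (k : ℕ) (c : ℤ) : ℕ := W (k + 1) c - W k c

/-- The combinatorial properties of `W k c = ∑ min (k, v (c - α))`, where `α` runs through the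
roots of a polynomial: `W k c` depends on `c` modulo `p ^ k` only and increases with `k`, and the
increment at a residue class is at least the sum of the increments at the `p` classes into which it
splits. -/
structure IsValuationTree (p : ℕ) (W : ℕ → ℤ → ℕ) : Prop where
  le_succ : ∀ k c, W k c ≤ W (k + 1) c
  congr : ∀ k x c, (p : ℤ) ^ k ∣ x - c → W k x = W k c
  sum_increment_le : ∀ k c, ∑ j ∈ Finset.range p,
    increment W (k + 1) (c + j * (p : ℤ) ^ (k + 1)) ≤ increment W k c

/-- The sum of the products of the increments of `W` and `V` over all residue classes modulo
`p ^ (k + 1), …, p ^ (k + n + 1)` inside the class of `c` modulo `p ^ (k + 1)`. -/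
def pairing (p : ℕ) (W V : ℕ → ℤ → ℕ) : ℕ → ℕ → ℤ → ℕ
  | 0, k, c => increment W k c * increment V k c
  | n + 1, k, c => increment W k c * increment V k c +
      ∑ j ∈ Finset.range p, pairing p W V n (k + 1) (c + j * (p : ℤ) ^ (k + 1))

theorem dvd_sub_of_dvd_sub_child {p k j : ℕ} {x c : ℤ}
    (h : (p : ℤ) ^ (k + 1) ∣ x - (c + j * (p : ℤ) ^ k)) : (p : ℤ) ^ k ∣ x - c := by
  have h1 := dvd_add ((pow_dvd_pow (p : ℤ) (Nat.le_succ k)).trans h) (Dvd.intro_left (j : ℤ) rfl)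
  rwa [show x - (c + j * (p : ℤ) ^ k) + j * (p : ℤ) ^ k = x - c by ring] at h1

theorem exists_child {p k : ℕ} (hp : 0 < p) {x c : ℤ} (h : (p : ℤ) ^ k ∣ x - c) :
    ∃ j < p, (p : ℤ) ^ (k + 1) ∣ x - (c + j * (p : ℤ) ^ k) := by
  obtain ⟨q, hq⟩ := h
  obtain ⟨j, hj⟩ := Int.eq_ofNat_of_zero_le (Int.emod_nonneg q (show (p : ℤ) ≠ 0 by positivity))
  have hjp := Int.emod_lt_of_pos q (show (0 : ℤ) < p by positivity)
  refine ⟨j, by omega, q / p, ?_⟩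
  have h1 := Int.emod_add_mul_ediv q p
  calc x - (c + j * (p : ℤ) ^ k) = (p : ℤ) ^ k * q - (p : ℤ) ^ k * j := by rw [← hq]; ring
    _ = (p : ℤ) ^ k * (q - j) := by ring
    _ = (p : ℤ) ^ k * (p * (q / p)) := by rw [← hj]; congr 1; omega
    _ = _ := by ring

namespace IsValuationTree

variable {p : ℕ} {W V : ℕ → ℤ → ℕ}

theorem add_increment (hW : IsValuationTree p W) (k : ℕ) (c : ℤ) :
    W k c + increment W k c = W (k + 1) c := by
  have := hW.le_succ k c
  unfold increment; omega

theorem apply_child (hW : IsValuationTree p W) (k : ℕ) (c : ℤ) (j : ℕ) :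
    W k (c + j * (p : ℤ) ^ k) = W k c :=
  hW.congr k _ _ ⟨j, by ring⟩

theorem mono (hW : IsValuationTree p W) (c : ℤ) : Monotone fun k => W k c :=
  monotone_nat_of_le_succ fun k => hW.le_succ k c

/-- Some child has an increment at most a `p`-th of that of its parent. Following such children,
a path is found along which `W` grows by at most `maxResolved`. -/
theorem exists_le_add_maxResolved (hp : 2 ≤ p) (hW : IsValuationTree p W) (n k : ℕ) (c : ℤ) :
    ∃ x, (p : ℤ) ^ (k + 1) ∣ x - c ∧
      W (k + 1 + n) x ≤ W k c + maxResolved p (increment W k c) := by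
  induction n generalizing k c with
  | zero =>
    refine ⟨c, by simp, ?_⟩
    have := le_maxResolved hp (increment W k c)
    have := hW.add_increment k c
    simp only [Nat.add_zero]; omega
  | succ n ih =>
    obtain ⟨j, -, hj⟩ : ∃ j ∈ Finset.range p,
        increment W (k + 1) (c + j * (p : ℤ) ^ (k + 1)) ≤ increment W k c / p := by
      by_contra! h
      have h1 : p * (increment W k c / p + 1) ≤
          ∑ j ∈ Finset.range p, increment W (k + 1) (c + j * (p : ℤ) ^ (k + 1)) := by
        have := Finset.card_nsmul_le_sum (Finset.range p) _ _ fun j hj => Nat.succ_le_of_lt (h j hj)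
        simpa using this
      have h2 := Nat.lt_mul_div_succ (increment W k c) (show 0 < p by omega)
      have h3 := hW.sum_increment_le k c
      omega
    obtain ⟨x, hx, hxW⟩ := ih (k + 1) (c + j * (p : ℤ) ^ (k + 1))
    refine ⟨x, dvd_sub_of_dvd_sub_child hx, ?_⟩
    · rw [hW.apply_child] at hxW
      have h1 := maxResolved_mono hp hj
      have h2 := maxResolved_eq hp (increment W k c)
      have h3 := hW.add_increment k c
      rw [show k + 1 + (n + 1) = k + 1 + 1 + n by ring]
      omega

/-- If `W` grows by at least `s` along every path through a class, then the increment at this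
class is at least the first term of the minimal resolution of `s`. -/
theorem minHead_le_increment (hp : 2 ≤ p) (hW : IsValuationTree p W) {n k s : ℕ} {c : ℤ}
    (h : ∀ x, (p : ℤ) ^ (k + 1) ∣ x - c → W k c + s ≤ W (k + 1 + n) x) :
    minHead p s ≤ increment W k c := by
  obtain ⟨x, hx, hxW⟩ := hW.exists_le_add_maxResolved hp n k c
  have := h x hx
  exact minHead_le_of_le (by omega)

/-- Along a path on which the increment vanishes once, it vanishes ever after. -/
theorem eq_of_increment_eq_zero (hW : IsValuationTree p W) (hp : 2 ≤ p) (n k : ℕ) (c x : ℤ)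
    (h0 : increment W k c = 0) (hx : (p : ℤ) ^ (k + 1) ∣ x - c) :
    W (k + 1 + n) x = W k c := by
  induction n generalizing k c with
  | zero =>
    have := hW.add_increment k c
    have := hW.congr (k + 1) x c hx
    simp only [Nat.add_zero]; omega
  | succ n ih =>
    obtain ⟨j, hjp, hj⟩ := exists_child (show 0 < p by omega) hx
    have h1 : increment W (k + 1) (c + j * (p : ℤ) ^ (k + 1)) = 0 := by
      have h2 := hW.sum_increment_le k c
      have h3 := Finset.single_le_sum
        (f := fun j : ℕ => increment W (k + 1) (c + j * (p : ℤ) ^ (k + 1)))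
        (fun _ _ => Nat.zero_le _) (Finset.mem_range.mpr hjp)
      omega
    have h4 := ih (k + 1) _ h1 hj
    rw [hW.apply_child, ← hW.add_increment, h0] at h4
    rw [show k + 1 + (n + 1) = k + 1 + 1 + n by ring]
    exact h4

/-- The lower bound for the pairing inside one residue class. Every path through the class has
growth at least `s` and `t`, and some path has growth at least `S` and `T`. -/
theorem greedyPairing_add_min_le_pairing (hp : 2 ≤ p) (hW : IsValuationTree p W)
    (hV : IsValuationTree p V) (n k : ℕ) (c : ℤ) (s t S T : ℕ)
    (hs : ∀ x, (p : ℤ) ^ (k + 1) ∣ x - c → W k c + s ≤ W (k + 1 + n) x)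
    (ht : ∀ x, (p : ℤ) ^ (k + 1) ∣ x - c → V k c + t ≤ V (k + 1 + n) x)
    (hST : ∃ x, (p : ℤ) ^ (k + 1) ∣ x - c ∧ W k c + S ≤ W (k + 1 + n) x ∧
      V k c + T ≤ V (k + 1 + n) x) :
    greedyPairing p (n + 1) s t + min (S - s) (T - t) ≤ pairing p W V n k c := by
  -- If an increment vanishes at `c`, the growth along the paths through `c` is zero. Otherwise the
  -- bounds for the subclasses, with what is left of `s`, `t`, `S`, `T`, are added up; where the
  -- subtraction from `s` or `t` truncates, `greedyPairing_succ_add_max_le` makes up for the loss.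
  induction n generalizing k c s t S T with
  | zero =>
    obtain ⟨x, hx, hxS, hxT⟩ := hST
    have ha := hW.minHead_le_increment hp hs
    have hb := hV.minHead_le_increment hp ht
    have h1 := hW.add_increment k c
    have h2 := hV.add_increment k c
    have h3 := hW.congr _ x c hx
    have h4 := hV.congr _ x c hx
    simp only [Nat.add_zero] at hxS hxT
    rcases Nat.eq_zero_or_pos (increment W k c) with ha0 | ha0
    · obtain rfl : s = 0 := by
        by_contra h
        have := minHead_pos hp (Nat.pos_of_ne_zero h)
        omega
      rw [greedyPairing_zero_left hp]
      omega
    rcases Nat.eq_zero_or_pos (increment V k c) with hb0 | hb0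
    · obtain rfl : t = 0 := by
        by_contra h
        have := minHead_pos hp (Nat.pos_of_ne_zero h)
        omega
      rw [greedyPairing_comm, greedyPairing_zero_left hp]
      omega
    have h5 := greedyPairing_succ_add_max_le hp 0 ha hb ha0 hb0
    simp only [pairing]
    simp only [greedyPairing] at h5 ⊢
    omega
  | succ n ih =>
    obtain ⟨x, hx, hxS, hxT⟩ := hST
    have ha := hW.minHead_le_increment hp hs
    have hb := hV.minHead_le_increment hp ht
    rcases Nat.eq_zero_or_pos (increment W k c) with ha0 | ha0
    · obtain rfl : s = 0 := by
        by_contra h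
        have := minHead_pos hp (Nat.pos_of_ne_zero h)
        omega
      have := hW.eq_of_increment_eq_zero hp (n + 1) k c x ha0 hx
      rw [greedyPairing_zero_left hp]
      omega
    rcases Nat.eq_zero_or_pos (increment V k c) with hb0 | hb0
    · obtain rfl : t = 0 := by
        by_contra h
        have := minHead_pos hp (Nat.pos_of_ne_zero h)
        omega
      have := hV.eq_of_increment_eq_zero hp (n + 1) k c x hb0 hx
      rw [greedyPairing_comm, greedyPairing_zero_left hp]
      omega
    set a := increment W k c with ha_def
    set b := increment V k c with hb_def
    have h1 := hW.add_increment k c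
    have h2 := hV.add_increment k c
    -- The bound for the `j`-th subclass; only the one containing `x` is used with large `S'`, `T'`.
    have key : ∀ j : ℕ, ∀ S' T' : ℕ,
        (∃ x, (p : ℤ) ^ (k + 1 + 1) ∣ x - (c + j * (p : ℤ) ^ (k + 1)) ∧
          W (k + 1) c + S' ≤ W (k + 1 + 1 + n) x ∧ V (k + 1) c + T' ≤ V (k + 1 + 1 + n) x) →
        greedyPairing p (n + 1) (s - a) (t - b) + min (S' - (s - a)) (T' - (t - b)) ≤
          pairing p W V n (k + 1) (c + j * (p : ℤ) ^ (k + 1)) := by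
      intro j S' T' hx
      refine ih (k + 1) _ (s - a) (t - b) S' T' (fun y hy => ?_) (fun y hy => ?_) ?_
      · have h3 := hs y (dvd_sub_of_dvd_sub_child hy)
        have h4 : W (k + 1 + 1) y ≤ W (k + 1 + 1 + n) y := hW.mono y (Nat.le_add_right _ _)
        have h5 := hW.le_succ (k + 1) y
        have h6 := hW.congr _ _ _ (dvd_sub_of_dvd_sub_child hy)
        rw [hW.apply_child]
        rw [show k + 1 + (n + 1) = k + 1 + 1 + n by ring] at h3
        omega
      · have h3 := ht y (dvd_sub_of_dvd_sub_child hy)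
        have h4 : V (k + 1 + 1) y ≤ V (k + 1 + 1 + n) y := hV.mono y (Nat.le_add_right _ _)
        have h5 := hV.le_succ (k + 1) y
        have h6 := hV.congr _ _ _ (dvd_sub_of_dvd_sub_child hy)
        rw [hV.apply_child]
        rw [show k + 1 + (n + 1) = k + 1 + 1 + n by ring] at h3
        omega
      · simpa only [hW.apply_child, hV.apply_child] using hx
    obtain ⟨j₀, hj₀p, hj₀⟩ := exists_child (show 0 < p by omega) hx
    set m := min ((S - a) - (s - a)) ((T - b) - (t - b)) with hm
    have hchild : ∀ j ∈ Finset.range p,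
        greedyPairing p (n + 1) (s - a) (t - b) + (if j = j₀ then m else 0) ≤
          pairing p W V n (k + 1) (c + j * (p : ℤ) ^ (k + 1)) := by
      intro j _
      split_ifs with h
      · subst h
        refine key j (S - a) (T - b) ⟨x, hj₀, ?_, ?_⟩
        · have h4 : W (k + 1) x ≤ W (k + 1 + 1 + n) x := hW.mono x (by omega)
          have h6 := hW.congr _ _ _ hx
          rw [show k + 1 + (n + 1) = k + 1 + 1 + n by ring] at hxS
          omega
        · have h4 : V (k + 1) x ≤ V (k + 1 + 1 + n) x := hV.mono x (by omega)
          have h6 := hV.congr _ _ _ hx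
          rw [show k + 1 + (n + 1) = k + 1 + 1 + n by ring] at hxT
          omega
      · have := key j 0 0 ⟨c + j * (p : ℤ) ^ (k + 1), by simp, ?_, ?_⟩
        · omega
        · rw [← hW.apply_child _ _ j]
          exact hW.mono _ (by omega)
        · rw [← hV.apply_child _ _ j]
          exact hV.mono _ (by omega)
    have hsum := Finset.sum_le_sum hchild
    rw [Finset.sum_add_distrib, Finset.sum_const, Finset.card_range, smul_eq_mul,
      Finset.sum_ite_eq' (Finset.range p) j₀, if_pos (Finset.mem_range.mpr hj₀p)] at hsum
    have h5 := greedyPairing_succ_add_max_le hp (n + 1) ha hb ha0 hb0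
    simp only [pairing, ← ha_def, ← hb_def]
    omega

end IsValuationTree

theorem sum_range_mul_eq {M : Type*} [AddCommMonoid M] (f : ℤ → M) (a b : ℕ) :
    ∑ c ∈ Finset.range (a * b), f c =
      ∑ c ∈ Finset.range a, ∑ j ∈ Finset.range b, f (c + j * (a : ℤ)) := by
  rw [Finset.sum_comm]
  induction b with
  | zero => simp
  | succ b ih =>
    rw [Nat.mul_succ, Finset.sum_range_add, ih, Finset.sum_range_succ]
    congr 1
    refine Finset.sum_congr rfl fun c _ => ?_
    congr 1
    push_cast
    ring

theorem sum_pairing (p : ℕ) (W V : ℕ → ℤ → ℕ) (n k : ℕ) :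
    ∑ c ∈ Finset.range (p ^ (k + 1)), pairing p W V n k c =
      ∑ i ∈ Finset.range (n + 1), ∑ c ∈ Finset.range (p ^ (k + i + 1)),
        increment W (k + i) c * increment V (k + i) c := by
  induction n generalizing k with
  | zero => simp [pairing]
  | succ n ih =>
    simp only [pairing]
    rw [Finset.sum_add_distrib, Finset.sum_range_succ', add_comm]
    congr 1
    have h1 := sum_range_mul_eq (fun c => pairing p W V n (k + 1) c) (p ^ (k + 1)) p
    rw [← pow_succ, ih (k + 1)] at h1
    push_cast at h1
    rw [← h1]
    refine Finset.sum_congr rfl fun i _ => ?_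
    rw [show k + (i + 1) = k + 1 + i by ring]

/-- The lower bound for the sum of the products of all increments: the residue class modulo `p`
that contains the path with large growth contributes the additional summand. -/
theorem IsValuationTree.le_sum_increment_mul_increment {p : ℕ} {W V : ℕ → ℤ → ℕ} (hp : 2 ≤ p)
    (hW : IsValuationTree p W) (hV : IsValuationTree p V) (n s t S T : ℕ)
    (hs : ∀ x, W 0 x + s ≤ W (n + 1) x) (ht : ∀ x, V 0 x + t ≤ V (n + 1) x)
    (hST : ∃ x, W 0 x + S ≤ W (n + 1) x ∧ V 0 x + T ≤ V (n + 1) x) :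
    p * greedyPairing p (n + 1) s t + min (S - s) (T - t) ≤
      ∑ i ∈ Finset.range (n + 1), ∑ c ∈ Finset.range (p ^ (i + 1)),
        increment W i c * increment V i c := by
  have h0 := sum_pairing p W V n 0
  simp only [Nat.zero_add, pow_one] at h0
  rw [← h0]
  obtain ⟨x, hxS, hxT⟩ := hST
  obtain ⟨j₀, hj₀p, hj₀⟩ := exists_child (k := 0) (x := x) (c := 0) (show 0 < p by omega) (by simp)
  have hW0 : ∀ x y, W 0 x = W 0 y := fun x y => hW.congr 0 x y (by simp)
  have hV0 : ∀ x y, V 0 x = V 0 y := fun x y => hV.congr 0 x y (by simp)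
  have key : ∀ j ∈ Finset.range p,
      greedyPairing p (n + 1) s t + (if j = j₀ then min (S - s) (T - t) else 0) ≤
        pairing p W V n 0 j := by
    intro j _
    have h := fun S' T' => hW.greedyPairing_add_min_le_pairing hp hV n 0 j s t S' T'
      (fun y _ => by rw [hW0 j y, show 0 + 1 + n = n + 1 by ring]; exact hs y)
      (fun y _ => by rw [hV0 j y, show 0 + 1 + n = n + 1 by ring]; exact ht y)
    split_ifs with hj
    · subst hj
      refine h S T ⟨x, by simpa using hj₀, ?_⟩
      rw [hW0 j x, hV0 j x, show 0 + 1 + n = n + 1 by ring]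
      exact ⟨hxS, hxT⟩
    · have := h 0 0 ⟨j, by simp, hW.mono _ (by omega), hV.mono _ (by omega)⟩
      omega
  have hsum := Finset.sum_le_sum key
  rwa [Finset.sum_add_distrib, Finset.sum_const, Finset.card_range, smul_eq_mul,
    Finset.sum_ite_eq' (Finset.range p) j₀, if_pos (Finset.mem_range.mpr hj₀p)] at hsum

/-! ### Truncated valuations of `p`-adic algebraic numbers -/

/-- `min (k, v x)` for the valuation `v` of the algebraic closure of `ℚ_[p]` with `v p = 1`; the
truncation makes it a real number for `x = 0` as well. -/
noncomputable def truncVal (p : ℕ) [Fact p.Prime] (k : ℕ) (x : PadicAlgCl p) : ℝ :=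
  -Real.logb p (max ‖x‖ ((p : ℝ) ^ k)⁻¹)

/-- `min (1, max (0, v x - k))`: the part of the valuation of `x` between `k` and `k + 1`. -/
noncomputable def sliceVal (p : ℕ) [Fact p.Prime] (k : ℕ) (x : PadicAlgCl p) : ℝ :=
  truncVal p (k + 1) x - truncVal p k x

section Valuation

open Polynomial

variable {p : ℕ} [hp : Fact p.Prime]

theorem one_lt_natCast_prime : (1 : ℝ) < p := by exact_mod_cast hp.out.one_lt

theorem neg_logb_inv_pow (k : ℕ) : -Real.logb p ((p : ℝ) ^ k)⁻¹ = k := by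
  have h1 := one_lt_natCast_prime (p := p)
  rw [Real.logb_inv, Real.logb_pow, Real.logb_self_eq_one h1]; ring

theorem inv_pow_pos (k : ℕ) : 0 < ((p : ℝ) ^ k)⁻¹ := by
  have h1 := one_lt_natCast_prime (p := p)
  positivity

theorem inv_pow_succ_le (k : ℕ) : ((p : ℝ) ^ (k + 1))⁻¹ ≤ ((p : ℝ) ^ k)⁻¹ := by
  have h1 := one_lt_natCast_prime (p := p)
  gcongr
  · exact h1.le
  · omega

theorem norm_intCast_eq (n : ℤ) : ‖(n : PadicAlgCl p)‖ = ‖(n : ℚ_[p])‖ := by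
  rw [← PadicAlgCl.norm_extends, map_intCast]

theorem norm_intCast_le_one (n : ℤ) : ‖(n : PadicAlgCl p)‖ ≤ 1 := by
  rw [norm_intCast_eq]; exact Padic.norm_int_le_one n

theorem norm_intCast_le_iff (n : ℤ) (k : ℕ) :
    ‖(n : PadicAlgCl p)‖ ≤ ((p : ℝ) ^ k)⁻¹ ↔ (p : ℤ) ^ k ∣ n := by
  rw [norm_intCast_eq, ← Padic.norm_int_le_pow_iff_dvd, zpow_neg, zpow_natCast]

theorem exists_norm_intCast_eq {n : ℤ} (hn : n ≠ 0) :
    ∃ m : ℕ, emultiplicity (p : ℤ) n = m ∧ ‖(n : PadicAlgCl p)‖ = ((p : ℝ) ^ m)⁻¹ := by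
  have hfin : FiniteMultiplicity (p : ℤ) n :=
    Int.finiteMultiplicity_iff.mpr ⟨by simpa using hp.out.ne_one, hn⟩
  obtain ⟨u, hu, hpu⟩ := hfin.exists_eq_pow_mul_and_not_dvd
  refine ⟨multiplicity (p : ℤ) n, hfin.emultiplicity_eq_multiplicity, ?_⟩
  have h1 : ‖(u : ℚ_[p])‖ = 1 :=
    le_antisymm (Padic.norm_int_le_one u)
      (not_lt.mp fun h => hpu (Padic.norm_intCast_lt_one_iff.mp h))
  conv_lhs => rw [hu]
  rw [norm_intCast_eq]
  push_cast
  rw [norm_mul, h1, norm_pow, Padic.norm_p, mul_one, inv_pow]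

theorem truncVal_le_truncVal (k : ℕ) {x y : PadicAlgCl p} (h : ‖y‖ ≤ ‖x‖) :
    truncVal p k x ≤ truncVal p k y := by
  have h1 := one_lt_natCast_prime (p := p)
  unfold truncVal
  rw [neg_le_neg_iff]
  exact Real.logb_le_logb_of_le h1 (lt_max_of_lt_right (inv_pow_pos k)) (max_le_max_right _ h)

theorem truncVal_of_le {k : ℕ} {x : PadicAlgCl p} (h : ‖x‖ ≤ ((p : ℝ) ^ k)⁻¹) :
    truncVal p k x = k := by
  rw [truncVal, max_eq_right h, neg_logb_inv_pow]

theorem truncVal_of_ge {k : ℕ} {x : PadicAlgCl p} (h : ((p : ℝ) ^ k)⁻¹ ≤ ‖x‖) :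
    truncVal p k x = -Real.logb p ‖x‖ := by
  rw [truncVal, max_eq_left h]

theorem truncVal_le (k : ℕ) (x : PadicAlgCl p) : truncVal p k x ≤ k := by
  rw [← neg_logb_inv_pow (p := p) k, truncVal, neg_le_neg_iff]
  exact Real.logb_le_logb_of_le one_lt_natCast_prime (inv_pow_pos k) (le_max_right _ _)

theorem truncVal_le_neg_logb (k : ℕ) {x : PadicAlgCl p} (hx : x ≠ 0) :
    truncVal p k x ≤ -Real.logb p ‖x‖ := by
  rw [truncVal, neg_le_neg_iff]
  exact Real.logb_le_logb_of_le one_lt_natCast_prime (norm_pos_iff.mpr hx) (le_max_left _ _)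

theorem max_norm_add_eq_of_le {k : ℕ} {x y : PadicAlgCl p} (h : ‖y‖ ≤ ((p : ℝ) ^ k)⁻¹) :
    max ‖x + y‖ ((p : ℝ) ^ k)⁻¹ = max ‖x‖ ((p : ℝ) ^ k)⁻¹ := by
  refine le_antisymm (max_le ?_ (le_max_right _ _)) (max_le ?_ (le_max_right _ _))
  · exact (PadicAlgCl.isNonarchimedean p x y).trans (max_le_max_left _ h)
  · have h1 := PadicAlgCl.isNonarchimedean p (x + y) (-y)
    rw [add_neg_cancel_right, norm_neg] at h1
    exact h1.trans (max_le_max_left _ h)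

theorem truncVal_add_of_le {k : ℕ} {x y : PadicAlgCl p} (h : ‖y‖ ≤ ((p : ℝ) ^ k)⁻¹) :
    truncVal p k (x + y) = truncVal p k x := by
  rw [truncVal, max_norm_add_eq_of_le h, truncVal]

theorem sliceVal_of_ge {k : ℕ} {x : PadicAlgCl p} (h : ((p : ℝ) ^ k)⁻¹ ≤ ‖x‖) :
    sliceVal p k x = 0 := by
  rw [sliceVal, truncVal_of_ge h, truncVal_of_ge ((inv_pow_succ_le k).trans h), sub_self]

theorem sliceVal_of_le {k : ℕ} {x : PadicAlgCl p} (h : ‖x‖ ≤ ((p : ℝ) ^ k)⁻¹) :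
    sliceVal p k x = truncVal p (k + 1) x - k := by
  rw [sliceVal, truncVal_of_le h]

theorem sliceVal_of_le_succ {k : ℕ} {x : PadicAlgCl p} (h : ‖x‖ ≤ ((p : ℝ) ^ (k + 1))⁻¹) :
    sliceVal p k x = 1 := by
  rw [sliceVal_of_le (h.trans (inv_pow_succ_le k)), truncVal_of_le h]
  push_cast; ring

theorem sliceVal_nonneg (k : ℕ) (x : PadicAlgCl p) : 0 ≤ sliceVal p k x := by
  rw [sliceVal, truncVal, truncVal, sub_nonneg, neg_le_neg_iff]
  exact Real.logb_le_logb_of_le one_lt_natCast_prime (lt_max_of_lt_right (inv_pow_pos _))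
    (max_le_max_left _ (inv_pow_succ_le k))

theorem sliceVal_le_sliceVal (k : ℕ) {x y : PadicAlgCl p} (h : ‖y‖ ≤ ‖x‖) :
    sliceVal p k x ≤ sliceVal p k y := by
  rcases le_total ((p : ℝ) ^ k)⁻¹ ‖x‖ with hx | hx
  · rw [sliceVal_of_ge hx]; exact sliceVal_nonneg k y
  · rw [sliceVal_of_le hx, sliceVal_of_le (h.trans hx)]
    linarith [truncVal_le_truncVal (k + 1) h]

theorem sliceVal_le_one (k : ℕ) (x : PadicAlgCl p) : sliceVal p k x ≤ 1 := by
  rcases le_total ((p : ℝ) ^ k)⁻¹ ‖x‖ with hx | hx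
  · rw [sliceVal_of_ge hx]; norm_num
  · rw [sliceVal_of_le hx]
    have := truncVal_le (k + 1) x
    push_cast at this
    linarith

theorem norm_lt_of_sliceVal_ne_zero {k : ℕ} {x : PadicAlgCl p} (h : sliceVal p k x ≠ 0) :
    ‖x‖ < ((p : ℝ) ^ k)⁻¹ :=
  not_le.mp fun h1 => h (sliceVal_of_ge h1)

theorem sum_range_sliceVal (K : ℕ) (x : PadicAlgCl p) :
    ∑ k ∈ Finset.range K, sliceVal p k x = truncVal p K x - truncVal p 0 x :=
  Finset.sum_range_sub (fun k => truncVal p k x) K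

/-- An element close to two integers forces these integers to be congruent. -/
theorem dvd_sub_of_sliceVal_ne_zero {k : ℕ} {c d : ℤ} {x : PadicAlgCl p}
    (hc : sliceVal p k (c - x) ≠ 0) (hd : sliceVal p k (d - x) ≠ 0) :
    (p : ℤ) ^ (k + 1) ∣ c - d := by
  have h1 := norm_lt_of_sliceVal_ne_zero hc
  have h2 := norm_lt_of_sliceVal_ne_zero hd
  have h3 : ‖((c - d : ℤ) : PadicAlgCl p)‖ < ((p : ℝ) ^ k)⁻¹ := by
    have h4 := PadicAlgCl.isNonarchimedean p ((c : PadicAlgCl p) - x) (-((d : PadicAlgCl p) - x))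
    rw [norm_neg] at h4
    have h5 : (c : PadicAlgCl p) - x + -((d : PadicAlgCl p) - x) = ((c - d : ℤ) : PadicAlgCl p) := by
      push_cast; ring
    rw [h5] at h4
    exact h4.trans_lt (max_lt h1 h2)
  rw [← norm_intCast_le_iff (p := p)]
  by_cases h0 : c - d = 0
  · rw [h0]; simp
  obtain ⟨m, -, hm⟩ := exists_norm_intCast_eq (p := p) h0
  rw [hm] at h3 ⊢
  have hp1 := one_lt_natCast_prime (p := p)
  have h6 : k < m := by
    rwa [inv_lt_inv₀ (by positivity) (by positivity), pow_lt_pow_iff_right₀ hp1] at h3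
  gcongr
  · exact hp1.le
  · omega

/-- At most one residue class in each level is close to `x`, and then also close to `y` only if `x`
and `y` are close to each other. -/
theorem sum_sliceVal_mul_sliceVal_le (k : ℕ) (x y : PadicAlgCl p) :
    ∑ c ∈ Finset.range (p ^ (k + 1)),
      sliceVal p k (((c : ℤ) : PadicAlgCl p) - x) * sliceVal p k (((c : ℤ) : PadicAlgCl p) - y) ≤
        sliceVal p k (x - y) := by
  by_cases h : ∃ c ∈ Finset.range (p ^ (k + 1)), sliceVal p k (((c : ℤ) : PadicAlgCl p) - x) ≠ 0
  · obtain ⟨c, hc, hcx⟩ := h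
    rw [Finset.sum_eq_single c]
    · set u := ((c : ℤ) : PadicAlgCl p) - x with hu
      set w := ((c : ℤ) : PadicAlgCl p) - y with hw
      have h1 : ‖x - y‖ ≤ max ‖u‖ ‖w‖ := by
        have := PadicAlgCl.isNonarchimedean p (-u) w
        rwa [norm_neg, show -u + w = x - y by rw [hu, hw]; ring] at this
      have hu0 := sliceVal_nonneg k u
      have hw0 := sliceVal_nonneg k w
      have hu1 := sliceVal_le_one k u
      have hw1 := sliceVal_le_one k w
      -- A product of numbers in `[0, 1]` is at most either factor.
      rcases le_max_iff.mp h1 with h2 | h2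
      · nlinarith [sliceVal_le_sliceVal k h2]
      · nlinarith [sliceVal_le_sliceVal k h2]
    · intro d hd hdc
      by_cases hdx : sliceVal p k (((d : ℤ) : PadicAlgCl p) - x) = 0
      · rw [hdx, zero_mul]
      · exfalso
        apply hdc
        have h1 := dvd_sub_of_sliceVal_ne_zero hcx hdx
        have h2 : d ≡ c [MOD p ^ (k + 1)] := by
          rw [Nat.modEq_iff_dvd]; exact_mod_cast h1
        exact Nat.ModEq.eq_of_lt_of_lt h2 (Finset.mem_range.mp hd) (Finset.mem_range.mp hc)
    · exact fun h => absurd hc h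
  · push Not at h
    rw [Finset.sum_eq_zero fun c hc => by rw [h c hc, zero_mul]]
    exact sliceVal_nonneg k _

/-- At most one of the `p` subclasses of the class of `c` has a non-zero slice at `x`, and then the
slice of `c` one level above is complete. -/
theorem sum_sliceVal_child_le (k : ℕ) (c : ℤ) (x : PadicAlgCl p) :
    ∑ j ∈ Finset.range p,
      sliceVal p (k + 1) (((c + j * (p : ℤ) ^ (k + 1) : ℤ) : PadicAlgCl p) - x) ≤
        sliceVal p k ((c : PadicAlgCl p) - x) := by
  by_cases h : ∃ j ∈ Finset.range p,
      sliceVal p (k + 1) (((c + j * (p : ℤ) ^ (k + 1) : ℤ) : PadicAlgCl p) - x) ≠ 0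
  · obtain ⟨j, hj, hjx⟩ := h
    rw [Finset.sum_eq_single j]
    · refine (sliceVal_le_one _ _).trans (sliceVal_of_le_succ ?_).ge
      have h1 := (norm_lt_of_sliceVal_ne_zero hjx).le
      have h2 : ‖((-(j * (p : ℤ) ^ (k + 1)) : ℤ) : PadicAlgCl p)‖ ≤ ((p : ℝ) ^ (k + 1))⁻¹ :=
        (norm_intCast_le_iff _ _).mpr (Dvd.intro_left (-(j : ℤ)) (by ring))
      have h3 := PadicAlgCl.isNonarchimedean p
        (((c + j * (p : ℤ) ^ (k + 1) : ℤ) : PadicAlgCl p) - x)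
        ((-(j * (p : ℤ) ^ (k + 1)) : ℤ) : PadicAlgCl p)
      refine (le_of_eq ?_).trans (h3.trans (max_le h1 h2))
      congr 1
      push_cast; ring
    · intro i hi hij
      by_contra hix
      apply hij
      have h1 := dvd_sub_of_sliceVal_ne_zero hjx hix
      have h2 : (p : ℤ) ^ (k + 1) * p ∣ (p : ℤ) ^ (k + 1) * (j - i) := by
        rw [← pow_succ]
        convert h1 using 1; ring
      have h3 := Int.dvd_of_mul_dvd_mul_left
        (pow_ne_zero (k + 1) (by exact_mod_cast hp.out.ne_zero : (p : ℤ) ≠ 0)) h2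
      exact Nat.ModEq.eq_of_lt_of_lt (Nat.modEq_iff_dvd.mpr h3)
        (Finset.mem_range.mp hi) (Finset.mem_range.mp hj)
    · exact fun h => absurd hj h
  · push Not at h
    rw [Finset.sum_eq_zero h]
    exact sliceVal_nonneg k _

/-! ### Gauss norms and the valuations of the roots -/

theorem gaussNorm_X_add_C (b : PadicAlgCl p) {r : ℝ} (hr : 0 ≤ r) :
    (X + C b).gaussNorm (NormedField.toAbsoluteValue (PadicAlgCl p)) r = max ‖b‖ r := by
  apply le_antisymm
  · obtain ⟨i, hi⟩ := exists_eq_gaussNorm (NormedField.toAbsoluteValue (PadicAlgCl p)) r (X + C b)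
    rw [hi]
    match i with
    | 0 => simp [NormedField.toAbsoluteValue]
    | 1 => simp [NormedField.toAbsoluteValue]
    | i + 2 => simp [NormedField.toAbsoluteValue, coeff_X, hr]
  · refine max_le ?_ ?_
    · have := le_gaussNorm (NormedField.toAbsoluteValue (PadicAlgCl p)) (X + C b) hr 0
      simpa [NormedField.toAbsoluteValue] using this
    · have := le_gaussNorm (NormedField.toAbsoluteValue (PadicAlgCl p)) (X + C b) hr 1
      simpa [NormedField.toAbsoluteValue, coeff_C] using this

variable {f : ℤ[X]} {ι : Type*} [Fintype ι] {a : ι → PadicAlgCl p}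

theorem exists_eq_prod_X_sub_C (hf : f.Monic) : ∃ (n : ℕ) (a : Fin n → PadicAlgCl p),
    f.map (Int.castRingHom (PadicAlgCl p)) = ∏ i, (X - C (a i)) := by
  have h := (IsAlgClosed.splits (f.map (Int.castRingHom (PadicAlgCl p)))).eq_prod_roots_of_monic
    (hf.map _)
  set s := (f.map (Int.castRingHom (PadicAlgCl p))).roots
  refine ⟨s.toList.length, fun i => s.toList[i.1], ?_⟩
  refine h.trans ?_
  rw [Fin.prod_univ_fun_getElem s.toList (fun x => X - C x), ← Multiset.prod_coe,
    ← Multiset.map_coe, Multiset.coe_toList]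

theorem gaussNorm_taylor_eq (ha : f.map (Int.castRingHom (PadicAlgCl p)) = ∏ i, (X - C (a i)))
    (k : ℕ) (c : ℤ) :
    ((taylor c f).map (Int.castRingHom (PadicAlgCl p))).gaussNorm
      (NormedField.toAbsoluteValue (PadicAlgCl p)) ((p : ℝ) ^ k)⁻¹ =
        ∏ i, max ‖(c : PadicAlgCl p) - a i‖ ((p : ℝ) ^ k)⁻¹ := by
  have h1 : (taylor c f).map (Int.castRingHom (PadicAlgCl p)) =
      ∏ i, (X + C ((c : PadicAlgCl p) - a i)) := by
    rw [taylor_apply, Polynomial.map_comp, ha, prod_comp]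
    refine Finset.prod_congr rfl fun i _ => ?_
    simp; ring
  rw [h1]
  have hmul := fun F G : (PadicAlgCl p)[X] => gaussNorm_mul (v := NormedField.toAbsoluteValue _)
    (PadicAlgCl.isNonarchimedean p) (inv_pow_pos (p := p) k) F G
  have : ∀ s : Finset ι, (∏ i ∈ s, (X + C ((c : PadicAlgCl p) - a i))).gaussNorm
      (NormedField.toAbsoluteValue (PadicAlgCl p)) ((p : ℝ) ^ k)⁻¹ =
        ∏ i ∈ s, max ‖(c : PadicAlgCl p) - a i‖ ((p : ℝ) ^ k)⁻¹ := by
    classical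
    intro s
    induction s using Finset.induction with
    | empty =>
      have := gaussNorm_C (NormedField.toAbsoluteValue (PadicAlgCl p)) ((p : ℝ) ^ k)⁻¹ 1
      simpa using this
    | insert i s hi ih =>
      rw [Finset.prod_insert hi, Finset.prod_insert hi, hmul, ih,
        gaussNorm_X_add_C _ (inv_pow_pos k).le]
  exact this Finset.univ

/-- By multiplicativity of the Gauss norm, the truncated valuations of `c - α` over the roots `α`
add up to the valuation corresponding to the Gauss norm of `f (c + x)` with radius `p ^ (-k)`. -/
theorem sum_truncVal_eq (ha : f.map (Int.castRingHom (PadicAlgCl p)) = ∏ i, (X - C (a i)))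
    (k : ℕ) (c : ℤ) :
    ∑ i, truncVal p k ((c : PadicAlgCl p) - a i) =
      -Real.logb p (((taylor c f).map (Int.castRingHom (PadicAlgCl p))).gaussNorm
        (NormedField.toAbsoluteValue (PadicAlgCl p)) ((p : ℝ) ^ k)⁻¹) := by
  rw [gaussNorm_taylor_eq ha, Real.logb_prod _ _ fun i _ =>
    (lt_max_of_lt_right (inv_pow_pos k)).ne', ← Finset.sum_neg_distrib]
  rfl

theorem gaussNorm_taylor_pos (ha : f.map (Int.castRingHom (PadicAlgCl p)) = ∏ i, (X - C (a i)))
    (k : ℕ) (c : ℤ) :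
    0 < ((taylor c f).map (Int.castRingHom (PadicAlgCl p))).gaussNorm
      (NormedField.toAbsoluteValue (PadicAlgCl p)) ((p : ℝ) ^ k)⁻¹ := by
  rw [gaussNorm_taylor_eq ha]
  exact Finset.prod_pos fun i _ => lt_max_of_lt_right (inv_pow_pos k)

/-- The Gauss norm of an integral polynomial with radius `p ^ (-k)` is an integral power of `p`,
even though the valuations of the single roots may be fractions. -/
theorem exists_sum_truncVal_eq_natCast
    (ha : f.map (Int.castRingHom (PadicAlgCl p)) = ∏ i, (X - C (a i))) (k : ℕ) (c : ℤ) :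
    ∃ m : ℕ, ∑ i, truncVal p k ((c : PadicAlgCl p) - a i) = m := by
  have hpos := gaussNorm_taylor_pos ha k c
  rw [sum_truncVal_eq ha]
  obtain ⟨i, hi⟩ := exists_eq_gaussNorm (NormedField.toAbsoluteValue (PadicAlgCl p))
    ((p : ℝ) ^ k)⁻¹ ((taylor c f).map (Int.castRingHom (PadicAlgCl p)))
  rw [hi] at hpos ⊢
  rw [coeff_map] at hpos ⊢
  change 0 < ‖(((taylor c f).coeff i : ℤ) : PadicAlgCl p)‖ * _ at hpos
  have h0 : (taylor c f).coeff i ≠ 0 := by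
    intro h
    rw [h] at hpos
    simp at hpos
  obtain ⟨m, -, hm⟩ := exists_norm_intCast_eq (p := p) h0
  refine ⟨m + k * i, ?_⟩
  change -Real.logb p (‖(((taylor c f).coeff i : ℤ) : PadicAlgCl p)‖ * _) = _
  rw [hm, inv_pow, ← mul_inv, ← pow_mul, ← pow_add, neg_logb_inv_pow]

/-- All coefficients of `f (c + p ^ k * x)` but the constant one `f c` are divisible by `p ^ k`, so
the truncation loses no part of the valuation of `f c` below `k`. -/
theorem le_sum_truncVal (ha : f.map (Int.castRingHom (PadicAlgCl p)) = ∏ i, (X - C (a i)))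
    {k s : ℕ} (hsk : s ≤ k) {c : ℤ} (h : (p : ℤ) ^ s ∣ f.eval c) :
    (s : ℝ) ≤ ∑ i, truncVal p k ((c : PadicAlgCl p) - a i) := by
  rw [sum_truncVal_eq ha, ← neg_logb_inv_pow (p := p) s, neg_le_neg_iff]
  refine Real.logb_le_logb_of_le one_lt_natCast_prime (gaussNorm_taylor_pos ha k c) ?_
  have hp1 := one_lt_natCast_prime (p := p)
  obtain ⟨i, hi⟩ := exists_eq_gaussNorm (NormedField.toAbsoluteValue (PadicAlgCl p))
    ((p : ℝ) ^ k)⁻¹ ((taylor c f).map (Int.castRingHom (PadicAlgCl p)))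
  rw [hi, coeff_map]
  change ‖(((taylor c f).coeff i : ℤ) : PadicAlgCl p)‖ * _ ≤ _
  rcases Nat.eq_zero_or_pos i with rfl | hi0
  · rw [taylor_coeff_zero, pow_zero, mul_one]
    exact (norm_intCast_le_iff _ _).mpr h
  · have h1 : ((p : ℝ) ^ k)⁻¹ ^ i ≤ ((p : ℝ) ^ s)⁻¹ := by
      rw [inv_pow, ← pow_mul]
      gcongr
      · exact hp1.le
      · exact hsk.trans (Nat.le_mul_of_pos_right k hi0)
    calc _ ≤ 1 * ((p : ℝ) ^ s)⁻¹ := by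
          gcongr
          exact norm_intCast_le_one _
      _ = _ := one_mul _

/-- Roots of monic integral polynomials have norm at most one. -/
theorem norm_root_le_one (ha : f.map (Int.castRingHom (PadicAlgCl p)) = ∏ i, (X - C (a i)))
    (i : ι) : ‖a i‖ ≤ 1 := by
  -- The valuations truncated at level `0` are non-positive, but their sum is a natural number.
  obtain ⟨m, hm⟩ := exists_sum_truncVal_eq_natCast ha 0 0
  have hnonpos : ∀ j, truncVal p 0 (((0 : ℤ) : PadicAlgCl p) - a j) ≤ 0 := fun j => by
    simpa using truncVal_le 0 (((0 : ℤ) : PadicAlgCl p) - a j)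
  have h0 : truncVal p 0 (((0 : ℤ) : PadicAlgCl p) - a i) = 0 := by
    have h1 : ∑ j, truncVal p 0 (((0 : ℤ) : PadicAlgCl p) - a j) = 0 :=
      le_antisymm (Finset.sum_nonpos fun j _ => hnonpos j) (by rw [hm]; positivity)
    exact (Finset.sum_eq_zero_iff_of_nonpos fun j _ => hnonpos j).mp h1 i (Finset.mem_univ i)
  by_contra h
  rw [not_le] at h
  have h2 : 0 < Real.logb p ‖a i‖ := Real.logb_pos one_lt_natCast_prime h
  rw [truncVal_of_ge (by simpa using h.le)] at h0
  rw [Int.cast_zero, zero_sub, norm_neg] at h0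
  linarith

variable (a) in
/-- The sum of the valuations of `c - a i`, each truncated at `k`. It is defined as a rounded
value, but for the roots of an integral polynomial nothing is lost, see
`natCast_rootTree`. -/
noncomputable def rootTree (k : ℕ) (c : ℤ) : ℕ := ⌊∑ i, truncVal p k ((c : PadicAlgCl p) - a i)⌋₊

theorem natCast_rootTree (ha : f.map (Int.castRingHom (PadicAlgCl p)) = ∏ i, (X - C (a i)))
    (k : ℕ) (c : ℤ) :
    (rootTree a k c : ℝ) = ∑ i, truncVal p k ((c : PadicAlgCl p) - a i) := by
  obtain ⟨m, hm⟩ := exists_sum_truncVal_eq_natCast ha k c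
  rw [rootTree, hm, Nat.floor_natCast]

theorem rootTree_le_succ (ha : f.map (Int.castRingHom (PadicAlgCl p)) = ∏ i, (X - C (a i)))
    (k : ℕ) (c : ℤ) : rootTree a k c ≤ rootTree a (k + 1) c := by
  have : (rootTree a k c : ℝ) ≤ rootTree a (k + 1) c := by
    rw [natCast_rootTree ha, natCast_rootTree ha]
    exact Finset.sum_le_sum fun i _ => sub_nonneg.mp (sliceVal_nonneg k _)
  exact_mod_cast this

theorem natCast_increment_rootTree
    (ha : f.map (Int.castRingHom (PadicAlgCl p)) = ∏ i, (X - C (a i))) (k : ℕ) (c : ℤ) :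
    (increment (rootTree a) k c : ℝ) = ∑ i, sliceVal p k ((c : PadicAlgCl p) - a i) := by
  rw [increment, Nat.cast_sub (rootTree_le_succ ha k c), natCast_rootTree ha, natCast_rootTree ha,
    ← Finset.sum_sub_distrib]
  rfl

theorem isValuationTree_rootTree
    (ha : f.map (Int.castRingHom (PadicAlgCl p)) = ∏ i, (X - C (a i))) :
    IsValuationTree p (rootTree a) where
  le_succ := rootTree_le_succ ha
  congr k x c h := by
    unfold rootTree
    congr 1
    refine Finset.sum_congr rfl fun i _ => ?_
    rw [← norm_intCast_le_iff (p := p)] at h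
    rw [← truncVal_add_of_le (x := (c : PadicAlgCl p) - a i) h]
    push_cast
    congr 1; ring
  sum_increment_le k c := by
    have : (∑ j ∈ Finset.range p,
        (increment (rootTree a) (k + 1) (c + j * (p : ℤ) ^ (k + 1)) : ℝ)) ≤
          increment (rootTree a) k c := by
      simp only [natCast_increment_rootTree ha]
      rw [Finset.sum_comm]
      exact Finset.sum_le_sum fun i _ => sum_sliceVal_child_le k c (a i)
    exact_mod_cast this

theorem sum_sliceVal_le_neg_logb {x y : PadicAlgCl p} (hx : ‖x‖ ≤ 1) (hy : ‖y‖ ≤ 1)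
    (hxy : x - y ≠ 0) (K : ℕ) :
    ∑ k ∈ Finset.range K, ∑ c ∈ Finset.range (p ^ (k + 1)),
      sliceVal p k (((c : ℤ) : PadicAlgCl p) - x) * sliceVal p k (((c : ℤ) : PadicAlgCl p) - y) ≤
        -Real.logb p ‖x - y‖ := by
  refine (Finset.sum_le_sum fun k _ => sum_sliceVal_mul_sliceVal_le k x y).trans ?_
  rw [sum_range_sliceVal]
  have h1 : ‖x - y‖ ≤ 1 := by
    have := PadicAlgCl.isNonarchimedean p x (-y)
    rw [norm_neg, ← sub_eq_add_neg] at this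
    exact this.trans (max_le hx hy)
  have h2 : truncVal p 0 (x - y) = 0 := by
    rw [truncVal_of_le (by simpa using h1)]; simp
  rw [h2, sub_zero]
  exact truncVal_le_neg_logb K hxy

/-- The valuation of a non-zero resultant is the sum of the valuations of the differences of the
roots, hence bounds the sum of the products of the increments. -/
theorem sum_increment_mul_increment_le {g : ℤ[X]} {κ : Type*} [Fintype κ] {b : κ → PadicAlgCl p}
    (hf : f.Monic) (hg : g.Monic)
    (ha : f.map (Int.castRingHom (PadicAlgCl p)) = ∏ i, (X - C (a i)))
    (hb : g.map (Int.castRingHom (PadicAlgCl p)) = ∏ i, (X - C (b i)))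
    {m : ℕ} (hr : resultant f g ≠ 0) (hm : emultiplicity (p : ℤ) (resultant f g) = m) (K : ℕ) :
    ∑ k ∈ Finset.range K, ∑ c ∈ Finset.range (p ^ (k + 1)),
      increment (rootTree a) k c * increment (rootTree b) k c ≤ m := by
  have hres : ((resultant f g : ℤ) : PadicAlgCl p) = ∏ i, ∏ j, (a i - b j) := by
    have h1 := resultant_map_map f g f.natDegree g.natDegree (Int.castRingHom (PadicAlgCl p))
    have h2 : f.natDegree = (∏ i, (X - C (a i))).natDegree := by
      rw [← ha, hf.natDegree_map]
    have h3 : (∏ i, (X - C (b i))).natDegree ≤ g.natDegree := by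
      rw [← hb, hg.natDegree_map]
    rw [eq_intCast] at h1
    rw [← h1, ha, hb, h2, resultant_prod_left _ _ _ _ (by simp) h3]
    refine Finset.prod_congr rfl fun i _ => ?_
    rw [natDegree_X_sub_C, resultant_X_sub_C_left _ _ _ h3]
    simp [eval_prod]
  have hne : ∀ i j, a i - b j ≠ 0 := by
    have h1 : ((resultant f g : ℤ) : PadicAlgCl p) ≠ 0 := by exact_mod_cast hr
    rw [hres] at h1
    intro i j
    exact Finset.prod_ne_zero_iff.mp (Finset.prod_ne_zero_iff.mp h1 i (Finset.mem_univ i)) j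
      (Finset.mem_univ j)
  obtain ⟨m', hm', hnorm⟩ := exists_norm_intCast_eq (p := p) hr
  obtain rfl : m' = m := by rw [hm'] at hm; exact_mod_cast hm
  have hval : (m' : ℝ) = ∑ i, ∑ j, -Real.logb p ‖a i - b j‖ := by
    rw [← neg_logb_inv_pow (p := p) m', ← hnorm, hres, norm_prod, Real.logb_prod,
      ← Finset.sum_neg_distrib]
    · refine Finset.sum_congr rfl fun i _ => ?_
      rw [norm_prod, Real.logb_prod, ← Finset.sum_neg_distrib]
      exact fun j _ => norm_ne_zero_iff.mpr (hne i j)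
    · exact fun i _ => norm_ne_zero_iff.mpr (Finset.prod_ne_zero_iff.mpr fun j _ => hne i j)
  have key : (∑ k ∈ Finset.range K, ∑ c ∈ Finset.range (p ^ (k + 1)),
      (increment (rootTree a) k c * increment (rootTree b) k c : ℝ)) ≤ m' := by
    rw [hval]
    refine le_trans (le_of_eq ?_) (Finset.sum_le_sum fun i _ => Finset.sum_le_sum fun j _ =>
      sum_sliceVal_le_neg_logb (norm_root_le_one ha i) (norm_root_le_one hb j) (hne i j) K)
    -- It remains to move the summations over the roots outside.
    simp only [natCast_increment_rootTree ha, natCast_increment_rootTree hb, Finset.sum_mul_sum]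
    calc _ = ∑ k ∈ Finset.range K, ∑ i, ∑ c ∈ Finset.range (p ^ (k + 1)), ∑ j,
          sliceVal p k (((c : ℤ) : PadicAlgCl p) - a i) *
            sliceVal p k (((c : ℤ) : PadicAlgCl p) - b j) :=
          Finset.sum_congr rfl fun k _ => Finset.sum_comm
      _ = ∑ i, ∑ k ∈ Finset.range K, ∑ c ∈ Finset.range (p ^ (k + 1)), ∑ j,
          sliceVal p k (((c : ℤ) : PadicAlgCl p) - a i) *
            sliceVal p k (((c : ℤ) : PadicAlgCl p) - b j) := Finset.sum_comm
      _ = ∑ i, ∑ k ∈ Finset.range K, ∑ j, ∑ c ∈ Finset.range (p ^ (k + 1)),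
          sliceVal p k (((c : ℤ) : PadicAlgCl p) - a i) *
            sliceVal p k (((c : ℤ) : PadicAlgCl p) - b j) :=
          Finset.sum_congr rfl fun i _ => Finset.sum_congr rfl fun k _ => Finset.sum_comm
      _ = _ := Finset.sum_congr rfl fun i _ => Finset.sum_comm
  exact_mod_cast key

end Valuation

/-! ### Minimal resolutions -/

section MinimalResolution

variable {p : ℕ}

theorem greedy_eq_zero (hp : 2 ≤ p) (i : ℕ) {s : ℕ} (h : s ≤ i) : greedy p s i = 0 := by
  induction i generalizing s with
  | zero =>
    obtain rfl : s = 0 := by omega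
    exact minHead_zero hp
  | succ i ih =>
    refine ih ?_
    rcases Nat.eq_zero_or_pos s with rfl | hs
    · omega
    · have := minHead_pos hp hs
      omega

theorem mul_greedy_succ_le (hp : 2 ≤ p) (i s : ℕ) : p * greedy p s (i + 1) ≤ greedy p s i := by
  induction i generalizing s with
  | zero => exact mul_minHead_sub_le hp le_rfl
  | succ i ih => exact ih _

theorem sum_greedy (hp : 2 ≤ p) (n : ℕ) {s : ℕ} (h : s ≤ n) :
    ∑ i ∈ Finset.range n, greedy p s i = s := by
  induction n generalizing s with
  | zero => simp; omega
  | succ n ih =>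
    have h1 := minHead_le hp s
    have h2 : s - minHead p s ≤ n := by
      rcases Nat.eq_zero_or_pos s with rfl | hs
      · omega
      · have := minHead_pos hp hs
        omega
    rw [Finset.sum_range_succ']
    simp only [greedy]
    rw [ih h2]
    omega

theorem isResolution_greedy (hp : 2 ≤ p) (s : ℕ) :
    IsResolution integralTerms p s fun i => (greedy p s i : ℝ) := by
  refine ⟨fun i => ⟨_, rfl⟩, fun i => ?_, ?_⟩
  · change (p : ℝ) * (greedy p s (i + 1) : ℝ) ≤ greedy p s i
    exact_mod_cast mul_greedy_succ_le hp i s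
  have h : ∑ i ∈ Finset.range s, (greedy p s i : ℝ) = s := by
    exact_mod_cast sum_greedy hp s le_rfl
  have h1 : HasSum (fun i => (greedy p s i : ℝ)) (∑ i ∈ Finset.range s, (greedy p s i : ℝ)) :=
    hasSum_sum_of_ne_finset_zero fun i hi => by
      rw [greedy_eq_zero hp i (by simpa using hi), Nat.cast_zero]
  rwa [h] at h1

theorem sum_range_le_maxResolved (hp : 2 ≤ p) (n : ℕ) (c : ℕ → ℕ)
    (hc : ∀ i, p * c (i + 1) ≤ c i) : ∑ i ∈ Finset.range n, c i ≤ maxResolved p (c 0) := by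
  induction n generalizing c with
  | zero => simp
  | succ n ih =>
    have h1 := ih (fun i => c (i + 1)) fun i => hc (i + 1)
    have h2 : c 1 ≤ c 0 / p := (Nat.le_div_iff_mul_le (by omega)).mpr (by
      rw [mul_comm]; exact hc 0)
    have h3 := maxResolved_mono hp h2
    rw [Finset.sum_range_succ', maxResolved_eq hp (c 0)]
    simp only [Nat.zero_add] at h1
    omega

theorem IsResolution.minHead_le (hp : 2 ≤ p) {s : ℕ} {y : ℕ → ℝ}
    (hy : IsResolution integralTerms p s y) : (minHead p s : ℝ) ≤ y 0 := by
  choose c hc using hy.1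
  simp only at hc
  have hcp : ∀ i, p * c (i + 1) ≤ c i := fun i => by
    have := hy.2.1 i
    rw [← hc, ← hc] at this
    exact_mod_cast this
  have h1 : (s : ℝ) ≤ maxResolved p (c 0) := by
    refine le_of_tendsto' hy.2.2.tendsto_sum_nat fun n => ?_
    simp only [← hc]
    exact_mod_cast sum_range_le_maxResolved hp n c hcp
  rw [← hc]
  exact_mod_cast minHead_le_of_le (by exact_mod_cast h1)

theorem IsResolution.greedy_le (hp : 2 ≤ p) (i : ℕ) {s : ℕ} {y : ℕ → ℝ}
    (hy : IsResolution integralTerms p s y) (h : ∀ j < i, y j = greedy p s j) :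
    (greedy p s i : ℝ) ≤ y i := by
  induction i generalizing s y with
  | zero => exact hy.minHead_le hp
  | succ i ih =>
    have h0 : y 0 = minHead p s := h 0 (Nat.succ_pos i)
    refine ih (s := s - minHead p s) (y := fun j => y (j + 1))
      ⟨fun j => hy.1 (j + 1), fun j => hy.2.1 (j + 1), ?_⟩ fun j hj => h (j + 1) (by omega)
    rw [Nat.cast_sub (_root_.minHead_le hp s), ← h0]
    have := (hasSum_nat_add_iff' (f := y) 1).mpr hy.2.2
    simpa using this

/-- The integral minimal resolution is the greedy one. -/
theorem integralMinimalResolution_eq_greedy [hp : Fact p.Prime] (s i : ℕ) :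
    integralMinimalResolution p s i = greedy p s i := by
  have hp2 := hp.out.two_le
  have h : IsMinimalResolution integralTerms p s fun i => (greedy p s i : ℝ) := by
    refine ⟨isResolution_greedy hp2 s, fun y hy => ?_⟩
    by_contra hlt
    obtain ⟨i, hi, hlt⟩ : ∃ i, (∀ j < i, ofLex y j = greedy p s j) ∧
      ofLex y i < greedy p s i := not_le.mp hlt
    exact absurd (IsResolution.greedy_le hp2 i hy hi) (not_le.mpr hlt)
  exact congrFun (toLex.injective ((integralMinimalResolution_spec p s).unique h)) i

theorem IsResolution.eq_zero_of_le (hp : 1 ≤ p) {s : ℕ} {γ : ℕ → ℝ}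
    (h : IsResolution realTerms p s γ) {i : ℕ} (hi : s ≤ i) : γ i = 0 := by
  by_contra hne
  have h1 := h.geom_le hne
  have h2 := le_sum_range_pow hp (i + 1)
  have h3 : ∑ j ∈ Finset.range (i + 1), p ^ j ≤ s := by exact_mod_cast h1
  omega

/-- The geometric sequence with ratio `1 / p` and `N` terms is a real resolution as soon as `N`
terms are possible at all. -/
theorem isResolution_geometric (hp : 1 ≤ p) {N : ℕ} {t : ℝ} (hN : 0 < N)
    (h : ∑ j ∈ Finset.range N, (p : ℝ) ^ j ≤ t) :
    IsResolution realTerms p t fun i =>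
      if i < N then t / (∑ j ∈ Finset.range N, ((p : ℝ) ^ j)⁻¹) * ((p : ℝ) ^ i)⁻¹ else 0 := by
  have hp1 : (1 : ℝ) ≤ p := by exact_mod_cast hp
  have hp0 : (0 : ℝ) < p := by linarith
  set D : ℝ := ∑ j ∈ Finset.range N, ((p : ℝ) ^ j)⁻¹ with hD
  have hDpos : 0 < D := Finset.sum_pos (fun j _ => by positivity) ⟨0, by simpa using hN⟩
  have ht : 0 ≤ t := (Finset.sum_nonneg fun j _ => by positivity).trans h
  refine ⟨fun i => ?_, fun i => ?_, ?_⟩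
  · by_cases hi : i < N
    · right
      have hgeom : (p : ℝ) ^ (N - 1) * D ≤ t := by
        calc (p : ℝ) ^ (N - 1) * D = ∑ j ∈ Finset.range N, (p : ℝ) ^ (N - 1 - j) := by
              rw [hD, Finset.mul_sum]
              refine Finset.sum_congr rfl fun j hj => ?_
              have : j < N := by simpa using hj
              rw [pow_sub₀ _ hp0.ne' (show j ≤ N - 1 by omega)]
          _ = ∑ j ∈ Finset.range N, (p : ℝ) ^ j := Finset.sum_range_reflect (fun j => (p : ℝ) ^ j) N
          _ ≤ t := h
      have hxp : (p : ℝ) ^ i ≤ t / D :=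
        (pow_le_pow_right₀ hp1 (by omega)).trans ((le_div_iff₀ hDpos).2 hgeom)
      simp only [hi, if_true]
      rw [← div_eq_mul_inv, le_div_iff₀ (by positivity)]
      simpa using hxp
    · left; simp [hi]
  · by_cases hi : i + 1 < N
    · have hi' : i < N := by omega
      simp only [hi, hi', if_true]
      rw [pow_succ]
      apply le_of_eq
      field_simp
    · simp only [hi, if_false, mul_zero]
      split_ifs <;> positivity
  · have h1 : ∑ i ∈ Finset.range N, (if i < N then t / D * ((p : ℝ) ^ i)⁻¹ else 0) = t := by
      rw [Finset.sum_congr rfl fun i hi => if_pos (Finset.mem_range.mp hi), ← Finset.mul_sum,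
        div_mul_cancel₀ _ hDpos.ne']
    have h2 : HasSum (fun i => if i < N then t / D * ((p : ℝ) ^ i)⁻¹ else 0)
        (∑ i ∈ Finset.range N, (if i < N then t / D * ((p : ℝ) ^ i)⁻¹ else 0)) :=
      hasSum_sum_of_ne_finset_zero fun i hi => if_neg (by simpa using hi)
    rwa [h1] at h2

theorem realMinimalResolution_zero_mul_le [hp : Fact p.Prime] {N t : ℕ} (hN : 0 < N)
    (h : ∑ j ∈ Finset.range N, p ^ j ≤ t) :
    realMinimalResolution p t 0 * ∑ j ∈ Finset.range N, ((p : ℝ) ^ j)⁻¹ ≤ t := by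
  have hp0 : (0 : ℝ) < p := by exact_mod_cast hp.out.pos
  have hDpos : 0 < ∑ j ∈ Finset.range N, ((p : ℝ) ^ j)⁻¹ :=
    Finset.sum_pos (fun j _ => by positivity) ⟨0, by simpa using hN⟩
  have hres := isResolution_geometric hp.out.one_le hN (t := t) (by exact_mod_cast h)
  have hle := (realMinimalResolution_spec p t).2 (show toLex _ ∈ _ from hres)
  rw [← le_div_iff₀ hDpos]
  have h0 : realMinimalResolution p t 0 ≤ if 0 < N then
      (t : ℝ) / (∑ j ∈ Finset.range N, ((p : ℝ) ^ j)⁻¹) * ((p : ℝ) ^ 0)⁻¹ else 0 :=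
    Pi.apply_le_of_toLex hle (by simp)
  rwa [if_pos hN, pow_zero, inv_one, mul_one] at h0

/-- Chebyshev's sum inequality for two resolutions: the sequences `p ^ i * γ i` are decreasing. -/
theorem IsResolution.mul_sum_le (hp : 1 ≤ p) {s t : ℝ} {γ δ : ℕ → ℝ}
    (hγ : IsResolution realTerms p s γ) (hδ : IsResolution realTerms p t δ) (N : ℕ) :
    (∑ i ∈ Finset.range N, γ i) * ∑ i ∈ Finset.range N, δ i ≤
      (∑ i ∈ Finset.range N, (p : ℝ) ^ i * γ i * δ i) * ∑ i ∈ Finset.range N, ((p : ℝ) ^ i)⁻¹ := by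
  have hp0 : (0 : ℝ) < p := by exact_mod_cast hp
  have hanti : ∀ {u : ℝ} {ε : ℕ → ℝ}, IsResolution realTerms p u ε →
      Antitone fun i => (p : ℝ) ^ i * ε i := fun {u ε} h => antitone_nat_of_succ_le fun i => by
    rw [pow_succ, mul_assoc]
    exact mul_le_mul_of_nonneg_left (h.2.1 i) (by positivity)
  have h0 : 0 ≤ ∑ i ∈ Finset.range N, ∑ j ∈ Finset.range N,
      ((p : ℝ) ^ i)⁻¹ * ((p : ℝ) ^ j)⁻¹ * (((p : ℝ) ^ i * γ i - (p : ℝ) ^ j * γ j) *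
        ((p : ℝ) ^ i * δ i - (p : ℝ) ^ j * δ j)) := by
    refine Finset.sum_nonneg fun i _ => Finset.sum_nonneg fun j _ =>
      mul_nonneg (by positivity) ?_
    rcases le_total i j with hij | hij
    · exact mul_nonneg (sub_nonneg.mpr (hanti hγ hij)) (sub_nonneg.mpr (hanti hδ hij))
    · exact mul_nonneg_of_nonpos_of_nonpos (sub_nonpos.mpr (hanti hγ hij))
        (sub_nonpos.mpr (hanti hδ hij))
  have h1 : ∑ i ∈ Finset.range N, ∑ j ∈ Finset.range N,
      ((p : ℝ) ^ i)⁻¹ * ((p : ℝ) ^ j)⁻¹ * (((p : ℝ) ^ i * γ i - (p : ℝ) ^ j * γ j) *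
        ((p : ℝ) ^ i * δ i - (p : ℝ) ^ j * δ j)) =
      ∑ i ∈ Finset.range N, ∑ j ∈ Finset.range N,
        (((p : ℝ) ^ i * γ i * δ i) * ((p : ℝ) ^ j)⁻¹ + ((p : ℝ) ^ i)⁻¹ * ((p : ℝ) ^ j * γ j * δ j)
          - γ i * δ j - δ i * γ j) := by
    refine Finset.sum_congr rfl fun i _ => Finset.sum_congr rfl fun j _ => ?_
    field_simp
    ring
  rw [h1] at h0
  simp only [Finset.sum_sub_distrib, Finset.sum_add_distrib, ← Finset.sum_mul_sum] at h0
  linarith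

theorem IsResolution.sum_range_eq {s : ℝ} {γ : ℕ → ℝ} {A : Set ℝ} (h : IsResolution A p s γ)
    {N : ℕ} (hN : ∀ i, N ≤ i → γ i = 0) : ∑ i ∈ Finset.range N, γ i = s :=
  (hasSum_sum_of_ne_finset_zero fun i hi => hN i (by simpa using hi)).unique h.2.2

/-- The real minimal resolutions give at most the pairing that the integral ones give. -/
theorem sum_realMinimalResolution_le [hp : Fact p.Prime] {s t M : ℕ} (hs : s ≤ M) (ht : t ≤ M) :
    ∑ i ∈ Finset.range M, (p : ℝ) ^ i * realMinimalResolution p s i * realMinimalResolution p t i ≤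
      greedyPairing p M s t := by
  wlog hst : s ≤ t generalizing s t
  · have := this ht hs (le_of_not_ge hst)
    rw [greedyPairing_comm]
    refine le_trans (le_of_eq (Finset.sum_congr rfl fun i _ => ?_)) this
    ring
  have hp1 := hp.out.one_le
  have hp0 : (0 : ℝ) < p := by exact_mod_cast hp.out.pos
  have hγs := (realMinimalResolution_spec p s).1
  have hγt := (realMinimalResolution_spec p t).1
  change IsResolution realTerms p s (realMinimalResolution p s) at hγs
  change IsResolution realTerms p t (realMinimalResolution p t) at hγt
  rcases Nat.eq_zero_or_pos t with rfl | htpos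
  · rw [Finset.sum_eq_zero fun i _ => by rw [hγt.eq_zero_of_le hp1 (Nat.zero_le i), mul_zero]]
    positivity
  -- `N` is the largest possible number of non-zero terms of a resolution of `t`.
  set N := Nat.findGreatest (fun n => ∑ j ∈ Finset.range n, p ^ j ≤ t) t with hN
  have hN1 : ∑ j ∈ Finset.range N, p ^ j ≤ t :=
    Nat.findGreatest_spec (P := fun n => ∑ j ∈ Finset.range n, p ^ j ≤ t) (Nat.zero_le t) (by simp)
  have hN2 : ∀ n, ∑ j ∈ Finset.range n, p ^ j ≤ t → n ≤ N := fun n hn =>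
    Nat.le_findGreatest ((le_sum_range_pow hp1 n).trans hn) hn
  have hNpos : 0 < N := hN2 1 (by simpa using Nat.one_le_iff_ne_zero.mpr htpos.ne')
  have hNt : N ≤ t := Nat.findGreatest_le t
  set D : ℝ := ∑ j ∈ Finset.range N, ((p : ℝ) ^ j)⁻¹ with hD
  have hDpos : 0 < D := Finset.sum_pos (fun j _ => by positivity) ⟨0, by simpa using hNpos⟩
  have hsupp : ∀ {u : ℕ} {γ : ℕ → ℝ}, u ≤ t → IsResolution realTerms p u γ →
      ∀ i, N ≤ i → γ i = 0 := fun {u γ} hu h i hi => by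
    by_contra hne
    have h1 : ∑ j ∈ Finset.range (i + 1), p ^ j ≤ u := by exact_mod_cast h.geom_le hne
    have := hN2 (i + 1) (h1.trans hu)
    omega
  refine le_of_mul_le_mul_right ?_ hDpos
  have hgs := (isResolution_greedy hp.out.two_le s).mono integralTerms_subset
  have hgt := (isResolution_greedy hp.out.two_le t).mono integralTerms_subset
  calc _ ≤ (∑ i ∈ Finset.range M, realMinimalResolution p t 0 * realMinimalResolution p s i) * D := by
        refine mul_le_mul_of_nonneg_right (Finset.sum_le_sum fun i _ => ?_) hDpos.le
        have h1 := hγt.pow_mul_le 0 i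
        rw [Nat.zero_add] at h1
        have h2 := mul_le_mul_of_nonneg_right h1 (hγs.nonneg i)
        linarith
    _ = s * (realMinimalResolution p t 0 * D) := by
        rw [← Finset.mul_sum, hγs.sum_range_eq fun i hi => hγs.eq_zero_of_le hp1 (hs.trans hi)]
        ring
    _ ≤ s * t := by
        gcongr
        exact realMinimalResolution_zero_mul_le hNpos hN1
    _ = (∑ i ∈ Finset.range N, (greedy p s i : ℝ)) * ∑ i ∈ Finset.range N, (greedy p t i : ℝ) := by
        rw [hgs.sum_range_eq (hsupp hst hgs), hgt.sum_range_eq (hsupp le_rfl hgt)]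
    _ ≤ (∑ i ∈ Finset.range N, (p : ℝ) ^ i * greedy p s i * greedy p t i) * D :=
        hgs.mul_sum_le hp1 hgt N
    _ ≤ greedyPairing p M s t * D := by
        refine mul_le_mul_of_nonneg_right ?_ hDpos.le
        rw [greedyPairing_eq_sum]
        push_cast
        exact Finset.sum_le_sum_of_subset_of_nonneg
          (Finset.range_subset_range.mpr (hNt.trans ht)) fun i _ _ => by positivity

end MinimalResolution

/-! ### The bound for the resultant -/

open Polynomial in
/-- The bound for natural numbers: the growth of the trees of `f` and `g` between the levels `0` and
`n + 1` is at least as large as the valuations of the values of `f` and `g`, truncated at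
`n + 1`. -/
theorem greedyPairing_add_min_le_of_emultiplicity {p : ℕ} [hp : Fact p.Prime] {f g : ℤ[X]}
    (hf : f.Monic) (hg : g.Monic) {s t S m n : ℕ}
    (hs : ∀ x : ℤ, (p : ℤ) ^ s ∣ f.eval x) (ht : ∀ x : ℤ, (p : ℤ) ^ t ∣ g.eval x)
    (hS : ∃ x : ℤ, (p : ℤ) ^ S ∣ f.eval x ∧ (p : ℤ) ^ S ∣ g.eval x)
    (hsn : s ≤ n + 1) (htn : t ≤ n + 1) (hSn : S ≤ n + 1)
    (hr : resultant f g ≠ 0) (hm : emultiplicity (p : ℤ) (resultant f g) = m) :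
    p * greedyPairing p (n + 1) s t + min (S - s) (S - t) ≤ m := by
  obtain ⟨_, a, ha⟩ := exists_eq_prod_X_sub_C (p := p) hf
  obtain ⟨_, b, hb⟩ := exists_eq_prod_X_sub_C (p := p) hg
  have hle : ∀ {f : ℤ[X]} {d : ℕ} {a : Fin d → PadicAlgCl p},
      f.map (Int.castRingHom (PadicAlgCl p)) = ∏ i, (X - C (a i)) → ∀ {u : ℕ} {x : ℤ},
      u ≤ n + 1 → (p : ℤ) ^ u ∣ f.eval x → rootTree a 0 x + u ≤ rootTree a (n + 1) x := by
    intro f d a ha u x hu hx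
    have h1 : (u : ℝ) ≤ rootTree a (n + 1) x := by
      rw [natCast_rootTree ha]
      exact le_sum_truncVal ha hu hx
    have h2 : (rootTree a 0 x : ℝ) ≤ 0 := by
      rw [natCast_rootTree ha]
      exact Finset.sum_nonpos fun i _ => by simpa using truncVal_le 0 ((x : PadicAlgCl p) - a i)
    have h3 : rootTree a 0 x = 0 := by
      have : rootTree a 0 x ≤ 0 := by exact_mod_cast h2
      omega
    rw [h3, Nat.zero_add]
    exact_mod_cast h1
  obtain ⟨x, hxf, hxg⟩ := hS
  exact ((isValuationTree_rootTree ha).le_sum_increment_mul_increment hp.out.two_le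
    (isValuationTree_rootTree hb) n s t S S (fun x => hle ha hsn (hs x))
    (fun x => hle hb htn (ht x)) ⟨x, hle ha hSn hxf, hle hb hSn hxg⟩).trans
    (sum_increment_mul_increment_le hf hg ha hb hr hm (n + 1))

theorem mainTheorem1 (p : ℕ) [Fact p.Prime] (f g : Polynomial ℤ) (hf : f.Monic) (hg : g.Monic)
    (s₁ s₂ S : ℕ)
    (hs₁ : ∀ n : ℤ, (s₁ : ℕ∞) ≤ vp p (f.eval n))
    (hs₂ : ∀ n : ℤ, (s₂ : ℕ∞) ≤ vp p (g.eval n))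
    (hS : IsGreatest (Set.range fun n : ℤ => min (vp p (f.eval n)) (vp p (g.eval n))) (S : ℕ∞))
    (γ : ℕ → ℕ → ℝ)
    (hγ : γ = realMinimalResolution p ∨ γ = integralMinimalResolution p) :
    Summable (fun i : ℕ => (p : ℝ) ^ i * γ s₁ i * γ s₂ i) ∧
      (((S : ℝ) - max (s₁ : ℝ) (s₂ : ℝ) + p * ∑' i : ℕ, (p : ℝ) ^ i * γ s₁ i * γ s₂ i : ℝ) : EReal)
        ≤ ((vp p (Polynomial.resultant f g) : ENNReal) : EReal) := by
  have hp1 := (Fact.out : p.Prime).one_le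
  set n := s₁ + s₂ + S with hn
  have hres : IsResolution realTerms p s₁ (γ s₁) := by
    rcases hγ with rfl | rfl
    · exact (realMinimalResolution_spec p s₁).1
    · exact IsResolution.mono integralTerms_subset (integralMinimalResolution_spec p s₁).1
  have hzero : ∀ i ∉ Finset.range (n + 1), (p : ℝ) ^ i * γ s₁ i * γ s₂ i = 0 := fun i hi => by
    rw [hres.eq_zero_of_le hp1 (by simp at hi; omega), mul_zero, zero_mul]
  refine ⟨summable_of_ne_finset_zero hzero, ?_⟩
  rw [tsum_eq_sum hzero]
  have hle : ∑ i ∈ Finset.range (n + 1), (p : ℝ) ^ i * γ s₁ i * γ s₂ i ≤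
      greedyPairing p (n + 1) s₁ s₂ := by
    rcases hγ with rfl | rfl
    · exact sum_realMinimalResolution_le (by omega) (by omega)
    · simp only [integralMinimalResolution_eq_greedy, greedyPairing_eq_sum]
      push_cast
      exact le_rfl
  by_cases hr : Polynomial.resultant f g = 0
  · simp [vp, hr]
  obtain ⟨m, hm, -⟩ := exists_norm_intCast_eq (p := p) hr
  obtain ⟨x, hx⟩ := hS.1
  have hx' : (S : ℕ∞) ≤ min (vp p (f.eval x)) (vp p (g.eval x)) := hx.ge
  have key := greedyPairing_add_min_le_of_emultiplicity (p := p) (n := n) hf hg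
    (fun y => pow_dvd_of_le_emultiplicity (hs₁ y)) (fun y => pow_dvd_of_le_emultiplicity (hs₂ y))
    ⟨x, pow_dvd_of_le_emultiplicity (hx'.trans (min_le_left _ _)),
      pow_dvd_of_le_emultiplicity (hx'.trans (min_le_right _ _))⟩
    (by omega) (by omega) (by omega) hr hm
  rw [vp, hm]
  have h1 : (((m : ℕ∞) : ENNReal) : EReal) = ((m : ℝ) : EReal) := by
    rw [ENat.toENNReal_coe, ← ENNReal.ofReal_natCast, EReal.coe_ennreal_ofReal,
      max_eq_left (Nat.cast_nonneg m)]
  rw [h1, EReal.coe_le_coe_iff]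
  have h2 : (S : ℝ) - max (s₁ : ℝ) (s₂ : ℝ) ≤ (min (S - s₁) (S - s₂) : ℕ) := by
    have : S ≤ min (S - s₁) (S - s₂) + max s₁ s₂ := by omega
    rw [sub_le_iff_le_add]
    exact_mod_cast this
  have h3 : (p : ℝ) * greedyPairing p (n + 1) s₁ s₂ + (min (S - s₁) (S - s₂) : ℕ) ≤ m := by
    exact_mod_cast key
  have h4 := mul_le_mul_of_nonneg_left hle (Nat.cast_nonneg (α := ℝ) p)
  linarith
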